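/- For an integer $n$ let $\mathbf{BS}(1,n)=\langle a,t \mid t^{-1}at=a^n\rangle$, and for $g\in\mathbf{BS}(1,n)$ let $|g|$ be the least length of a word on $a^{\pm1},t^{\pm1}$ representing $g$. A quadratic equation over $\mathbf{BS}(1,n)$ in variables $z_1,\dots,z_k$ is an expression $W=1$, where $W$ is a word on the letters $z_1^{\pm1},\dots,z_k^{\pm1},a^{\pm1},t^{\pm1}$ (representing an element of $F(z_1,\dots,z_k)*\mathbf{BS}(1,n)$) in which every variable $z_i$ occurs exactly twice, each time as $z_i$ or as $z_i^{-1}$; $|W|$ denotes the length of the word $W$. A solution is a tuple $(g_1,\dots,g_k)\in\mathbf{BS}(1,n)^k$ such that the homomorphism $F(z_1,\dots,z_k)*\mathbf{BS}(1,n)\to\mathbf{BS}(1,n)$ that sends $z_i$ to $g_i$ and is the identity on $\mathbf{BS}(1,n)$ maps $W$ to $1$; its size is $\sum_{i=1}^k|g_i|$. Theorem. For every integer $n$ there is a constant $C$, depending only on $n$, such that every quadratic equation $W=1$ over $\mathbf{BS}(1,n)$ (in any number of variables) that has a solution has a solution of size at most $C\,|W|^3$. -/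

import Mathlib

/-- The two generators of a Baumslag-Solitar group. -/
inductive BSGen
  | a
  | t

/-- The single defining relator `t⁻¹ a ^ m t (a ^ n)⁻¹`. -/
def BSRels (m n : ℤ) : Set (FreeGroup BSGen) :=
  {(FreeGroup.of BSGen.t)⁻¹ * FreeGroup.of BSGen.a ^ m * FreeGroup.of BSGen.t *
    (FreeGroup.of BSGen.a ^ n)⁻¹}

/-- The Baumslag-Solitar group `BS(m,n) = ⟨a, t | t⁻¹ a ^ m t = a ^ n⟩`. -/
abbrev BS (m n : ℤ) : Type := PresentedGroup (BSRels m n)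

/-- The element of `BS(m,n)` represented by a word on `a, a⁻¹, t, t⁻¹`
(a letter `(s, true)` stands for `s`, a letter `(s, false)` for `s⁻¹`). -/
def BS.ofWord (m n : ℤ) (u : List (BSGen × Bool)) : BS m n :=
  PresentedGroup.mk (BSRels m n) (FreeGroup.mk u)

/-- Every element of `BS(m,n)` is represented by a word, so that the infimum in `BS.wordLength`
is a minimum over a nonempty set. -/
theorem BS.exists_word {m n : ℤ} (g : BS m n) :
    ∃ u : List (BSGen × Bool), BS.ofWord m n u = g := by
  obtain ⟨x, rfl⟩ := PresentedGroup.mk_surjective (BSRels m n) g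
  obtain ⟨u, rfl⟩ := Quot.exists_rep x
  exact ⟨u, rfl⟩

/-- The word metric: the least length of a word on `a, a⁻¹, t, t⁻¹` representing `g`. -/
noncomputable def BS.wordLength {m n : ℤ} (g : BS m n) : ℕ :=
  sInf {l : ℕ | ∃ u : List (BSGen × Bool), BS.ofWord m n u = g ∧ u.length = l}

/-- A word on the letters `z_1, …, z_k, a, t` and their inverses: the left-hand side `W` of an
equation `W = 1` with `k` variables and with constants written as words on `a, t`. -/
abbrev EqWord (k : ℕ) : Type := List ((Fin k ⊕ BSGen) × Bool)

/-- The number of occurrences of the variable `z_i` (as `z_i` or as `z_i⁻¹`) in a word. -/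
def EqWord.occurrences {k : ℕ} (W : EqWord k) (i : Fin k) : ℕ :=
  (W.filterMap fun l => l.1.getLeft?).count i

/-- An equation is quadratic if each variable occurs exactly twice. -/
def EqWord.IsQuadratic {k : ℕ} (W : EqWord k) : Prop :=
  ∀ i : Fin k, W.occurrences i = 2

/-- The element of the free product `F(z_1, …, z_k) * BS(m,n)` given by a word. -/
def EqWord.toFreeProduct {k : ℕ} (m n : ℤ) (W : EqWord k) :
    Monoid.Coprod (FreeGroup (Fin k)) (BS m n) :=
  FreeGroup.lift
    (Sum.elim (fun i => Monoid.Coprod.inl (FreeGroup.of i))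
      (fun s => Monoid.Coprod.inr (PresentedGroup.of s)))
    (FreeGroup.mk W)

/-- `g` solves `W = 1` over `BS(m,n)`: the homomorphism from `F(z_1, …, z_k) * BS(m,n)` to
`BS(m,n)` with `z_i ↦ g i`, identical on `BS(m,n)`, sends `W` to `1`. -/
def EqWord.IsSolution {k : ℕ} {m n : ℤ} (W : EqWord k) (g : Fin k → BS m n) : Prop :=
  Monoid.Coprod.lift (FreeGroup.lift g) (MonoidHom.id (BS m n)) (W.toFreeProduct m n) = 1

/-- The size of a tuple: the sum of the word lengths of its entries. -/
noncomputable def BS.tupleSize {k : ℕ} {m n : ℤ} (g : Fin k → BS m n) : ℕ :=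
  ∑ i, BS.wordLength (g i)

/-! ### The affine group -/

/-- The group of pairs `(x, m)` with `(x, m) * (y, l) = (x + u ^ m * y, m + l)`: the semidirect
product of the additive group of `R` with `ℤ`, which acts through the unit `u`. -/
@[ext] structure ScaleTranslate {R : Type*} [CommRing R] (u : Rˣ) where
  trans : R
  exp : ℤ

namespace ScaleTranslate

variable {R : Type*} [CommRing R] {u : Rˣ}

instance : Mul (ScaleTranslate u) :=
  ⟨fun x y => ⟨x.trans + (u ^ x.exp : Rˣ) * y.trans, x.exp + y.exp⟩⟩

instance : One (ScaleTranslate u) := ⟨⟨0, 0⟩⟩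

instance : Inv (ScaleTranslate u) :=
  ⟨fun x => ⟨-((u ^ (-x.exp) : Rˣ) * x.trans), -x.exp⟩⟩

@[simp] theorem mul_trans (x y : ScaleTranslate u) :
    (x * y).trans = x.trans + (u ^ x.exp : Rˣ) * y.trans := rfl

@[simp] theorem mul_exp (x y : ScaleTranslate u) : (x * y).exp = x.exp + y.exp := rfl

@[simp] theorem one_trans : (1 : ScaleTranslate u).trans = 0 := rfl

@[simp] theorem one_exp : (1 : ScaleTranslate u).exp = 0 := rfl

@[simp] theorem inv_trans (x : ScaleTranslate u) :
    x⁻¹.trans = -((u ^ (-x.exp) : Rˣ) * x.trans) := rfl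

@[simp] theorem inv_exp (x : ScaleTranslate u) : x⁻¹.exp = -x.exp := rfl

instance : Group (ScaleTranslate u) :=
  Group.ofLeftAxioms
    (by
      intro x y z
      ext
      · simp only [mul_trans, mul_exp, zpow_add, Units.val_mul]; ring
      · simp only [mul_exp]; ring)
    (by intro x; ext <;> simp)
    (by intro x; ext <;> simp)

theorem zpow_translation (r : R) (j : ℤ) :
    (⟨r, 0⟩ : ScaleTranslate u) ^ j = ⟨j * r, 0⟩ := by
  induction j using Int.induction_on with
  | zero => ext <;> simp
  | succ i ih =>
    rw [zpow_add_one, ih]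
    ext
    · simp; ring
    · simp
  | pred i ih =>
    rw [zpow_sub_one, ih]
    ext
    · simp; ring
    · simp

theorem zpow_scaling (m j : ℤ) : (⟨0, m⟩ : ScaleTranslate u) ^ j = ⟨0, j * m⟩ := by
  induction j using Int.induction_on with
  | zero => ext <;> simp
  | succ i ih =>
    rw [zpow_add_one, ih]
    ext
    · simp
    · simp; ring
  | pred i ih =>
    rw [zpow_sub_one, ih]
    ext
    · simp
    · simp; ring

end ScaleTranslate

/-! ### The affine representation and normal forms -/

namespace BS

variable {n : ℤ}

/-- The generator `a` of `BS(1,n)`. -/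
def ga (n : ℤ) : BS 1 n := PresentedGroup.of BSGen.a

/-- The generator `t` of `BS(1,n)`. -/
def gt (n : ℤ) : BS 1 n := PresentedGroup.of BSGen.t

theorem conj_relation (n : ℤ) : (gt n)⁻¹ * ga n * gt n = ga n ^ n := by
  have h : PresentedGroup.mk (BSRels 1 n) ((FreeGroup.of BSGen.t)⁻¹ * FreeGroup.of BSGen.a ^ (1 : ℤ)
      * FreeGroup.of BSGen.t * (FreeGroup.of BSGen.a ^ n)⁻¹) = 1 :=
    PresentedGroup.one_of_mem (by simp [BSRels])
  simp only [map_mul, map_inv, map_zpow, zpow_one] at h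
  exact mul_inv_eq_one.mp h

/-- The images of the generators under the homomorphism `BS.toScaleTranslate`. -/
def genImage {R : Type*} [CommRing R] (u : Rˣ) : BSGen → ScaleTranslate u
  | BSGen.a => ⟨1, 0⟩
  -- The sign is forced by `t⁻¹ a t = a ^ n`: it is `t⁻¹` that multiplies translations by `n`.
  | BSGen.t => ⟨0, -1⟩

/-- The homomorphism from `BS(1,n)` to the affine group over a ring in which `n` is the unit `u`. -/
def toScaleTranslate {R : Type*} [CommRing R] (u : Rˣ) (hu : (u : R) = n) :
    BS 1 n →* ScaleTranslate u :=
  PresentedGroup.toGroup (f := genImage u) (by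
    intro r hr
    rw [BSRels, Set.mem_singleton_iff] at hr
    subst hr
    simp only [map_mul, map_inv, map_zpow, FreeGroup.lift_apply_of, genImage,
      ScaleTranslate.zpow_translation]
    ext <;> simp [hu])

variable {R : Type*} [CommRing R] (u : Rˣ) (hu : (u : R) = n)

theorem toScaleTranslate_of (s : BSGen) :
    toScaleTranslate u hu (PresentedGroup.of s) = genImage u s :=
  PresentedGroup.toGroup.of _

/-- The element `t ^ (-p) * a ^ j * t ^ (p - m)`, which maps to `(n ^ p * j, m)`. -/
def normalForm (n p j m : ℤ) : BS 1 n := gt n ^ (-p) * ga n ^ j * gt n ^ (p - m)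

theorem toScaleTranslate_normalForm (p j m : ℤ) :
    toScaleTranslate u hu (normalForm n p j m) = ⟨(u ^ p : Rˣ) * j, m⟩ := by
  simp only [normalForm, gt, ga, map_mul, map_zpow, toScaleTranslate_of, genImage,
    ScaleTranslate.zpow_translation, ScaleTranslate.zpow_scaling]
  ext <;> simp

theorem gt_inv_mul_zpow (j : ℤ) : (gt n)⁻¹ * ga n ^ j = ga n ^ (n * j) * (gt n)⁻¹ := by
  have h : (gt n)⁻¹ * ga n ^ j * gt n = ga n ^ (n * j) := by
    rw [zpow_mul, ← conj_relation]
    have := conj_zpow (a := (gt n)⁻¹) (b := ga n) (i := j)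
    rw [inv_inv] at this
    exact this.symm
  rw [← h]; group

theorem gt_inv_pow_mul_zpow (q : ℕ) (j : ℤ) :
    (gt n)⁻¹ ^ q * ga n ^ j = ga n ^ (n ^ q * j) * (gt n)⁻¹ ^ q := by
  induction q generalizing j with
  | zero => simp
  | succ q ih => rw [pow_succ, mul_assoc, gt_inv_mul_zpow, ← mul_assoc, ih, mul_assoc]; congr 2; ring

/-- Appending a letter preserves this shape: `a ^ e` moves left past `t⁻¹ ^ q` and picks up the
factor `n ^ q`, while `t` cancels a `t⁻¹` or, if `q = 0`, passes `a ^ j` by `a ^ j * t = t * a ^ (n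
* j)`. No division by `n` occurs, so `n = 0` is included. -/
theorem exists_pow_mul_zpow_mul_pow (g : BS 1 n) :
    ∃ (p q : ℕ) (j : ℤ), g = gt n ^ p * ga n ^ j * (gt n)⁻¹ ^ q := by
  obtain ⟨w, rfl⟩ := exists_word g
  induction w using List.reverseRecOn with
  | nil => exact ⟨0, 0, 0, by simp [ofWord, ← FreeGroup.one_eq_mk]⟩
  | append_singleton w s ih =>
    obtain ⟨p, q, j, h⟩ := ih
    have hmul : ofWord 1 n (w ++ [s]) = ofWord 1 n w * ofWord 1 n [s] := by
      rw [ofWord, ofWord, ofWord, ← map_mul, FreeGroup.mul_mk]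
    have ha : ∀ e : ℤ, gt n ^ p * ga n ^ j * (gt n)⁻¹ ^ q * ga n ^ e
        = gt n ^ p * ga n ^ (j + n ^ q * e) * (gt n)⁻¹ ^ q := by
      intro e
      rw [mul_assoc _ _ (ga n ^ e), gt_inv_pow_mul_zpow, zpow_add]; simp only [mul_assoc]
    rw [hmul, h]
    obtain ⟨s, b⟩ := s
    cases s <;> cases b
    · have : ofWord 1 n [(BSGen.a, false)] = ga n ^ (-1 : ℤ) := by
        rw [zpow_neg_one]; rfl
      rw [this]
      exact ⟨_, _, _, ha _⟩
    · have : ofWord 1 n [(BSGen.a, true)] = ga n ^ (1 : ℤ) := by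
        rw [zpow_one]; rfl
      rw [this]
      exact ⟨_, _, _, ha _⟩
    · have : ofWord 1 n [(BSGen.t, false)] = (gt n)⁻¹ := rfl
      rw [this]
      exact ⟨p, q + 1, j, by rw [pow_succ, mul_assoc _ _ (gt n)⁻¹]⟩
    · have : ofWord 1 n [(BSGen.t, true)] = gt n := rfl
      rw [this]
      cases q with
      | zero =>
        refine ⟨p + 1, 0, n * j, ?_⟩
        have := gt_inv_mul_zpow (n := n) j
        rw [inv_mul_eq_iff_eq_mul] at this
        simp only [pow_zero, mul_one]
        rw [mul_assoc, this]
        rw [pow_succ]; group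
      | succ q => exact ⟨p, q, j, by rw [pow_succ]; group⟩

/-- An element `t ^ p * a ^ j * t⁻¹ ^ q` has image `(n ^ (-p) * j, q - p)`, which over `ℚ` is
trivial only for `j = 0` and `p = q`. -/
theorem toScaleTranslate_injective (u : ℚˣ) (hu : (u : ℚ) = n) :
    Function.Injective (toScaleTranslate u hu) := by
  rw [injective_iff_map_eq_one]
  intro g hg
  obtain ⟨p, q, j, rfl⟩ := exists_pow_mul_zpow_mul_pow g
  have e : gt n ^ p * ga n ^ j * (gt n)⁻¹ ^ q = normalForm n (-p) j (q - p) := by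
    rw [normalForm, neg_neg, zpow_natCast, inv_pow, ← zpow_natCast _ q, ← zpow_neg]
    congr 2; ring
  rw [e, toScaleTranslate_normalForm] at hg
  have h1 := congrArg ScaleTranslate.trans hg
  have h2 := congrArg ScaleTranslate.exp hg
  simp only [ScaleTranslate.one_trans, ScaleTranslate.one_exp] at h1 h2
  have h3 : (j : ℚ) = 0 := (Units.mul_right_eq_zero _).mp h1
  have h4 : j = 0 := by exact_mod_cast h3
  have h5 : p = q := by omega
  subst h4 h5
  simp

/-! ### Word length -/

theorem wordLength_ofWord_le (w : List (BSGen × Bool)) :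
    wordLength (ofWord 1 n w) ≤ w.length :=
  Nat.sInf_le ⟨w, rfl, rfl⟩

theorem exists_word_length (g : BS 1 n) :
    ∃ w, ofWord 1 n w = g ∧ w.length = wordLength g := by
  have : {l : ℕ | ∃ u : List (BSGen × Bool), ofWord 1 n u = g ∧ u.length = l}.Nonempty := by
    obtain ⟨w, hw⟩ := exists_word g
    exact ⟨w.length, w, hw, rfl⟩
  exact Nat.sInf_mem this

theorem wordLength_mul_le (g h : BS 1 n) :
    wordLength (g * h) ≤ wordLength g + wordLength h := by
  obtain ⟨v, rfl, hv⟩ := exists_word_length g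
  obtain ⟨w, rfl, hw⟩ := exists_word_length h
  have hmul : ofWord 1 n v * ofWord 1 n w = ofWord 1 n (v ++ w) := by
    rw [ofWord, ofWord, ofWord, ← map_mul, FreeGroup.mul_mk]
  rw [← hv, ← hw, hmul, ← List.length_append]
  exact wordLength_ofWord_le _

theorem wordLength_one : wordLength (1 : BS 1 n) = 0 := by
  have := wordLength_ofWord_le (n := n) []
  have h : ofWord 1 n [] = 1 := by simp [ofWord, ← FreeGroup.one_eq_mk]
  rw [h] at this
  simpa using this

theorem wordLength_inv_le (g : BS 1 n) : wordLength g⁻¹ ≤ wordLength g := by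
  obtain ⟨v, rfl, hv⟩ := exists_word_length g
  have h : (ofWord 1 n v)⁻¹ = ofWord 1 n (FreeGroup.invRev v) := by
    rw [ofWord, ofWord, ← map_inv, FreeGroup.inv_mk]
  rw [← hv, h, ← FreeGroup.invRev_length (L₁ := v)]
  exact wordLength_ofWord_le _

theorem wordLength_pow_le (g : BS 1 n) (j : ℕ) : wordLength (g ^ j) ≤ j * wordLength g := by
  induction j with
  | zero => simp [wordLength_one]
  | succ j ih =>
    rw [pow_succ]
    have := wordLength_mul_le (g ^ j) g
    linarith

theorem wordLength_zpow_le (g : BS 1 n) (j : ℤ) :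
    wordLength (g ^ j) ≤ j.natAbs * wordLength g := by
  obtain h | h := Int.natAbs_eq j
  · have e : g ^ j = g ^ j.natAbs := by rw [← zpow_natCast, ← h]
    rw [e]; exact wordLength_pow_le _ _
  · have e : g ^ j = (g ^ j.natAbs)⁻¹ := by rw [← zpow_natCast, ← zpow_neg, ← h]
    rw [e]; exact (wordLength_inv_le _).trans (wordLength_pow_le _ _)

theorem wordLength_gen_zpow_le (s : BSGen) (j : ℤ) :
    wordLength ((PresentedGroup.of s : BS 1 n) ^ j) ≤ j.natAbs := by
  have h : wordLength (PresentedGroup.of s : BS 1 n) ≤ 1 :=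
    wordLength_ofWord_le (n := n) [(s, true)]
  exact (wordLength_zpow_le _ j).trans ((Nat.mul_le_mul_left _ h).trans_eq (mul_one _))

theorem wordLength_gt_zpow_le (j : ℤ) : wordLength (gt n ^ j) ≤ j.natAbs :=
  wordLength_gen_zpow_le _ j

theorem wordLength_ga_zpow_le (j : ℤ) : wordLength (ga n ^ j) ≤ j.natAbs :=
  wordLength_gen_zpow_le _ j

/-- Powers of `a` are logarithmically distorted. -/
theorem wordLength_ga_zpow_le_of_le (hn : n ≠ 0) (q s : ℕ) (j : ℤ)
    (hj : j.natAbs ≤ q * n.natAbs ^ s) :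
    wordLength (ga n ^ j) ≤ (n.natAbs + 2) * (s + q) := by
  induction s generalizing j with
  | zero =>
    have := wordLength_ga_zpow_le (n := n) j
    simp only [pow_zero, mul_one] at hj
    have h : q ≤ (n.natAbs + 2) * (0 + q) := by
      rw [zero_add]; exact Nat.le_mul_of_pos_left _ (by omega)
    omega
  | succ s ih =>
    have hpos : 0 < n.natAbs := Int.natAbs_pos.mpr hn
    -- Expansion in base `n`, as in Horner's scheme. Truncated division makes the absolute value of
    -- the quotient the quotient of the absolute values, also for negative `n` or `j`.
    have h1 : (j.tdiv n).natAbs ≤ q * n.natAbs ^ s := by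
      rw [Int.natAbs_tdiv]
      apply Nat.div_le_of_le_mul
      rw [pow_succ] at hj
      linarith
    have h2 : (j.tmod n).natAbs < n.natAbs := by
      rw [Int.natAbs_tmod]
      exact Nat.mod_lt _ hpos
    have h3 : ga n ^ j = (gt n) ^ (-1 : ℤ) * ga n ^ (j.tdiv n) * gt n ^ (1 : ℤ)
        * ga n ^ (j.tmod n) := by
      rw [zpow_neg_one, gt_inv_mul_zpow, zpow_one, inv_mul_cancel_right, ← zpow_add,
        Int.mul_tdiv_add_tmod]
    rw [h3]
    have e1 := wordLength_mul_le (gt n ^ (-1 : ℤ) * ga n ^ (j.tdiv n) * gt n ^ (1 : ℤ))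
      (ga n ^ (j.tmod n))
    have e2 := wordLength_mul_le (gt n ^ (-1 : ℤ) * ga n ^ (j.tdiv n)) (gt n ^ (1 : ℤ))
    have e3 := wordLength_mul_le (gt n ^ (-1 : ℤ)) (ga n ^ (j.tdiv n))
    have e4 := wordLength_gt_zpow_le (n := n) (-1)
    have e5 := wordLength_gt_zpow_le (n := n) 1
    have e6 := wordLength_ga_zpow_le (n := n) (j.tmod n)
    have e7 := ih _ h1
    simp only [Int.natAbs_neg, Int.natAbs_one] at e4 e5
    have e8 : (n.natAbs + 2) * (s + 1 + q) = (n.natAbs + 2) * (s + q) + (n.natAbs + 2) := by ring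
    omega

theorem wordLength_normalForm_le (p j m : ℤ) :
    wordLength (normalForm n p j m) ≤ 2 * p.natAbs + m.natAbs + wordLength (ga n ^ j) := by
  have e1 := wordLength_mul_le (gt n ^ (-p) * ga n ^ j) (gt n ^ (p - m))
  have e2 := wordLength_mul_le (gt n ^ (-p)) (ga n ^ j)
  have e3 := wordLength_gt_zpow_le (n := n) (-p)
  have e4 := wordLength_gt_zpow_le (n := n) (p - m)
  rw [normalForm]
  omega

end BS

/-! ### Quadratic words as labelled paths -/

instance : DecidableEq BSGen := fun x y => by
  cases x <;> cases y <;> first | exact isTrue rfl | exact isFalse (by simp)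

/-- The sign of a letter. -/
def letterSign (b : Bool) : ℤ := cond b 1 (-1)

theorem letterSign_eq (b : Bool) : letterSign b = 1 ∨ letterSign b = -1 := by
  cases b <;> simp [letterSign]

theorem abs_letterSign (b : Bool) : |letterSign b| = 1 := by
  cases b <;> simp [letterSign]

/-- A word of length `len` on variables and generators in which the variable `i` occurs precisely
at the positions `fst i < snd i`. -/
structure QuadraticWord (k : ℕ) where
  len : ℕ
  letter : ℕ → (Fin k ⊕ BSGen) × Bool
  fst : Fin k → ℕ
  snd : Fin k → ℕ
  fst_lt_snd : ∀ i, fst i < snd i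
  snd_lt : ∀ i, snd i < len
  letter_fst : ∀ i, (letter (fst i)).1 = Sum.inl i
  letter_snd : ∀ i, (letter (snd i)).1 = Sum.inl i
  eq_or_eq : ∀ l < len, ∀ i, (letter l).1 = Sum.inl i → l = fst i ∨ l = snd i

theorem EqWord.countP_take {k : ℕ} (W : EqWord k) (d : (Fin k ⊕ BSGen) × Bool) (i : Fin k)
    (l : ℕ) (hl : l ≤ W.length) :
    (W.take l).countP (fun x => x.1 = Sum.inl i)
      = ((Finset.range l).filter fun j => (W.getD j d).1 = Sum.inl i).card := by
  induction l with
  | zero => simp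
  | succ l ih =>
    have hl' : l < W.length := hl
    have e : W.getD l d = W[l] := List.getD_eq_getElem _ _ hl'
    rw [List.take_succ_eq_append_getElem hl', List.countP_append, ih hl'.le, Finset.range_add_one,
      Finset.filter_insert, e]
    by_cases h : (W[l]).1 = Sum.inl i
    · simp [h]
    · simp [h]

theorem EqWord.occurrences_eq_card {k : ℕ} (W : EqWord k) (d : (Fin k ⊕ BSGen) × Bool)
    (i : Fin k) :
    W.occurrences i
      = ((Finset.range W.length).filter fun j => (W.getD j d).1 = Sum.inl i).card := by
  rw [← W.countP_take d i _ le_rfl, List.take_length, EqWord.occurrences, List.count,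
    List.countP_filterMap]
  congr 1
  funext x
  obtain ⟨x | x, b⟩ := x
  · rw [Bool.eq_iff_iff]; simp
  · simp

/-- The default letter `a` only fills positions beyond the end of the word and affects no sum below
`D.len`. -/
theorem EqWord.IsQuadratic.exists_quadraticWord {k : ℕ} {W : EqWord k} (hW : W.IsQuadratic) :
    ∃ D : QuadraticWord k, D.len = W.length ∧
      D.letter = fun j => W.getD j (Sum.inr BSGen.a, true) := by
  have h : ∀ i, ∃ p q, p < q ∧ ((Finset.range W.length).filter fun j =>
      (W.getD j (Sum.inr BSGen.a, true)).1 = Sum.inl i) = {p, q} := by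
    intro i
    have := hW i
    rw [W.occurrences_eq_card (Sum.inr BSGen.a, true), Finset.card_eq_two] at this
    obtain ⟨x, y, hne, h⟩ := this
    rcases lt_or_gt_of_ne hne with hlt | hlt
    · exact ⟨x, y, hlt, h⟩
    · exact ⟨y, x, hlt, by rw [h, Finset.pair_comm]⟩
  choose p q hpq h using h
  have hm : ∀ i l, (l < W.length ∧ (W.getD l (Sum.inr BSGen.a, true)).1 = Sum.inl i) ↔
      l = p i ∨ l = q i := by
    intro i l
    have := Finset.ext_iff.mp (h i) l
    simpa only [Finset.mem_filter, Finset.mem_range, Finset.mem_insert, Finset.mem_singleton]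
      using this
  exact ⟨⟨W.length, _, p, q, hpq, fun i => ((hm i _).mpr (Or.inr rfl)).1,
    fun i => ((hm i _).mpr (Or.inl rfl)).2, fun i => ((hm i _).mpr (Or.inr rfl)).2,
    fun l hl i hi => (hm i l).mp ⟨hl, hi⟩⟩, rfl, rfl⟩

/-- The heights of the letters when the variables have exponents `m`. -/
def letterHeight {k : ℕ} (m : Fin k → ℤ) : Fin k ⊕ BSGen → ℤ
  | Sum.inl i => m i
  | Sum.inr BSGen.a => 0
  | Sum.inr BSGen.t => -1

/-- The translation parts of the letters when the variables have translation parts `x`. -/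
def letterTrans {k : ℕ} {R : Type*} [CommRing R] (x : Fin k → R) : Fin k ⊕ BSGen → R
  | Sum.inl i => x i
  | Sum.inr BSGen.a => 1
  | Sum.inr BSGen.t => 0

namespace QuadraticWord

variable {k : ℕ} (D : QuadraticWord k)

/-- The sign of the letter at position `l`. -/
def sign (l : ℕ) : ℤ := letterSign (D.letter l).2

theorem sign_eq (l : ℕ) : D.sign l = 1 ∨ D.sign l = -1 := letterSign_eq _

theorem abs_sign (l : ℕ) : |D.sign l| = 1 := abs_letterSign _

/-- The exponent of the prefix of length `l` when the letters have exponents `f`. -/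
def height (f : Fin k ⊕ BSGen → ℤ) (l : ℕ) : ℤ :=
  ∑ j ∈ Finset.range l, D.sign j * f (D.letter j).1

/-- The initial vertex of the letter at position `l`, read in positive direction. -/
def src (l : ℕ) : ℕ := cond (D.letter l).2 l (l + 1)

/-- The terminal vertex of the letter at position `l`, read in positive direction. -/
def tgt (l : ℕ) : ℕ := cond (D.letter l).2 (l + 1) l

theorem src_cases (l : ℕ) :
    (D.sign l = 1 ∧ D.src l = l ∧ D.tgt l = l + 1) ∨
      (D.sign l = -1 ∧ D.src l = l + 1 ∧ D.tgt l = l) := by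
  unfold sign src tgt letterSign
  cases (D.letter l).2 <;> simp

theorem src_le {l : ℕ} (hl : l < D.len) : D.src l ≤ D.len := by
  have := D.src_cases l; omega

theorem tgt_le {l : ℕ} (hl : l < D.len) : D.tgt l ≤ D.len := by
  have := D.src_cases l; omega

theorem fst_lt (i : Fin k) : D.fst i < D.len := (D.fst_lt_snd i).trans (D.snd_lt i)

theorem height_succ (f : Fin k ⊕ BSGen → ℤ) (l : ℕ) :
    D.height f (l + 1) = D.height f l + D.sign l * f (D.letter l).1 :=
  Finset.sum_range_succ _ _

theorem height_add (f g : Fin k ⊕ BSGen → ℤ) (l : ℕ) :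
    D.height (f + g) l = D.height f l + D.height g l := by
  simp [height, mul_add, Finset.sum_add_distrib]

theorem sum_split {A : Type*} [AddCommMonoid A] (F : ℕ → A) :
    ∑ l ∈ Finset.range D.len, F l = ∑ i, (F (D.fst i) + F (D.snd i))
      + ∑ l ∈ (Finset.range D.len).filter (fun l => (D.letter l).1.isRight), F l := by
  rw [← Finset.sum_filter_add_sum_filter_not (Finset.range D.len)
    (fun l => (D.letter l).1.isRight), add_comm]
  congr 1
  have h : ∀ i, F (D.fst i) + F (D.snd i) = ∑ l ∈ (Finset.range D.len).filter
      (fun l => (D.letter l).1 = Sum.inl i), F l := by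
    intro i
    rw [← Finset.sum_pair (D.fst_lt_snd i).ne]
    apply Finset.sum_congr _ fun _ _ => rfl
    ext l
    simp only [Finset.mem_insert, Finset.mem_singleton, Finset.mem_filter, Finset.mem_range]
    constructor
    · rintro (rfl | rfl)
      · exact ⟨D.fst_lt i, D.letter_fst i⟩
      · exact ⟨D.snd_lt i, D.letter_snd i⟩
    · rintro ⟨hl, h⟩
      exact D.eq_or_eq l hl i h
  simp_rw [h]
  rw [← Finset.sum_biUnion]
  · apply Finset.sum_congr _ fun _ _ => rfl
    ext l
    simp only [Finset.mem_filter, Finset.mem_range, Finset.mem_biUnion, Finset.mem_univ,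
      true_and]
    constructor
    · rintro ⟨hl, h⟩
      cases e : (D.letter l).1 with
      | inl i => exact ⟨i, hl, rfl⟩
      | inr s => simp [e] at h
    · rintro ⟨i, hl, h⟩
      exact ⟨hl, by simp [h]⟩
  · intro i _ j _ hij
    rw [Function.onFun, Finset.disjoint_left]
    intro l hl hl'
    exact hij (Sum.inl_injective ((Finset.mem_filter.mp hl).2.symm.trans (Finset.mem_filter.mp hl').2))

theorem two_mul_card_le : 2 * k ≤ D.len := by
  have := D.sum_split (fun _ => 1)
  simp only [Finset.sum_const, Finset.card_range, smul_eq_mul, mul_one, Finset.card_univ,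
    Fintype.card_fin] at this
  omega

/-! ### Evaluation -/

section Evaluation

variable {R : Type*} [CommRing R] (u : Rˣ)

/-- The coefficient of the variable `i`. -/
def coeff (m : Fin k → ℤ) (i : Fin k) : R :=
  D.sign (D.fst i) * (u ^ D.height (letterHeight m) (D.src (D.fst i)) : Rˣ)
    + D.sign (D.snd i) * (u ^ D.height (letterHeight m) (D.src (D.snd i)) : Rˣ)

/-- The constant term. -/
def const (m : Fin k → ℤ) : R :=
  ∑ l ∈ (Finset.range D.len).filter (fun l => (D.letter l).1 = Sum.inr BSGen.a),
    D.sign l * (u ^ D.height (letterHeight m) (D.src l) : Rˣ)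

/-- The tuple `(x, m)` solves the equation over the affine group of `R`. -/
def Solves (x : Fin k → R) (m : Fin k → ℤ) : Prop :=
  D.height (letterHeight m) D.len = 0 ∧ ∑ i, x i * D.coeff u m i + D.const u m = 0

/-- The image of a letter. -/
def letterImage {G : Type*} [Group G] (f : Fin k ⊕ BSGen → G) (s : (Fin k ⊕ BSGen) × Bool) : G :=
  cond s.2 (f s.1) (f s.1)⁻¹

variable {u}

/-- An inverse letter of exponent `m`, read from height `h`, contributes `-u ^ (h - m)` times its
translation part, and `h - m` is the height of its other end. This is why the height is taken at
`src` for both signs. -/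
theorem prod_take {x : Fin k → R} {m : Fin k → ℤ} {f : Fin k ⊕ BSGen → ScaleTranslate u}
    (hf : ∀ s, f s = ⟨letterTrans x s, letterHeight m s⟩) (W : EqWord k)
    (hD : D.letter = fun j => W.getD j (Sum.inr BSGen.a, true)) (l : ℕ) (hl : l ≤ W.length) :
    ((W.take l).map (letterImage f)).prod =
      ⟨∑ j ∈ Finset.range l, D.sign j * (u ^ D.height (letterHeight m) (D.src j) : Rˣ)
        * letterTrans x (D.letter j).1, D.height (letterHeight m) l⟩ := by
  induction l with
  | zero => ext <;> simp [height]
  | succ l ih =>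
    have hl' : l < W.length := hl
    have e : W[l] = D.letter l := by rw [hD]; exact (List.getD_eq_getElem _ _ hl').symm
    rw [List.take_succ_eq_append_getElem hl', List.map_append, List.prod_append, ih hl'.le,
      Finset.sum_range_succ, D.height_succ, List.map_singleton, List.prod_singleton, e]
    have hs := D.height_succ (letterHeight m) l
    unfold letterImage sign src letterSign at *
    rcases hb : (D.letter l).2 with _ | _
    · simp only [hb, cond_false] at hs ⊢
      ext
      · simp only [hf, ScaleTranslate.mul_trans, ScaleTranslate.inv_trans, hs]
        rw [zpow_add, neg_one_mul]
        simp [mul_assoc]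
      · simp [hf]
    · simp only [cond_true]
      ext
      · simp [hf]
      · simp [hf]

theorem prod_eq_one_iff {x : Fin k → R} {m : Fin k → ℤ} {f : Fin k ⊕ BSGen → ScaleTranslate u}
    (hf : ∀ s, f s = ⟨letterTrans x s, letterHeight m s⟩) (W : EqWord k)
    (hD : D.letter = fun j => W.getD j (Sum.inr BSGen.a, true)) (hlen : D.len = W.length) :
    (W.map (letterImage f)).prod = 1 ↔ D.Solves u x m := by
  have h := D.prod_take hf W hD W.length le_rfl
  rw [List.take_length] at h
  rw [h, ← hlen, D.sum_split, ScaleTranslate.ext_iff, Solves, and_comm]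
  simp only [ScaleTranslate.one_exp, ScaleTranslate.one_trans]
  refine and_congr_right fun _ => ?_
  have e1 : ∀ i, x i * D.coeff u m i =
      D.sign (D.fst i) * (u ^ D.height (letterHeight m) (D.src (D.fst i)) : Rˣ)
        * letterTrans x (D.letter (D.fst i)).1
      + D.sign (D.snd i) * (u ^ D.height (letterHeight m) (D.src (D.snd i)) : Rˣ)
        * letterTrans x (D.letter (D.snd i)).1 := by
    intro i
    rw [D.letter_fst, D.letter_snd, coeff]
    simp only [letterTrans]
    ring
  have e2 : D.const u m = ∑ l ∈ (Finset.range D.len).filter (fun l => (D.letter l).1.isRight),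
      (D.sign l : R) * ((u ^ D.height (letterHeight m) (D.src l) : Rˣ) : R)
        * letterTrans x (D.letter l).1 := by
    rw [const, Finset.sum_filter, Finset.sum_filter]
    refine Finset.sum_congr rfl fun l _ => ?_
    rcases (D.letter l).1 with i | s
    · simp
    · cases s <;> simp [letterTrans]
  rw [e2, Finset.sum_congr rfl fun i _ => e1 i]

end Evaluation

end QuadraticWord

/-! ### Passing between the group and the linear equation -/

theorem EqWord.isSolution_iff {k : ℕ} {n : ℤ} (W : EqWord k) (g : Fin k → BS 1 n) :
    W.IsSolution g ↔
      (W.map (QuadraticWord.letterImage (Sum.elim g PresentedGroup.of))).prod = 1 := by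
  rw [EqWord.IsSolution, EqWord.toFreeProduct, FreeGroup.lift_mk, map_list_prod, List.map_map]
  have e : ((Monoid.Coprod.lift (FreeGroup.lift g) (MonoidHom.id (BS 1 n))) ∘
      fun x : (Fin k ⊕ BSGen) × Bool => cond x.2
        (Sum.elim (fun i => Monoid.Coprod.inl (FreeGroup.of i))
          (fun s => Monoid.Coprod.inr (PresentedGroup.of s)) x.1 :
            Monoid.Coprod (FreeGroup (Fin k)) (BS 1 n))
        (Sum.elim (fun i => Monoid.Coprod.inl (FreeGroup.of i))
          (fun s => Monoid.Coprod.inr (PresentedGroup.of s)) x.1)⁻¹) =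
      QuadraticWord.letterImage (Sum.elim g PresentedGroup.of) := by
    funext ⟨x, b⟩
    cases x <;> cases b <;> simp [QuadraticWord.letterImage]
  rw [e]

namespace QuadraticWord

variable {k : ℕ} (D : QuadraticWord k) {n : ℤ} {R : Type*} [CommRing R] (u : Rˣ)
  (hu : (u : R) = n)

theorem map_letterImage_prod (W : EqWord k) (g : Fin k → BS 1 n) :
    BS.toScaleTranslate u hu
        (W.map (letterImage (Sum.elim g PresentedGroup.of))).prod
      = (W.map (letterImage fun s => BS.toScaleTranslate u hu
          (Sum.elim g PresentedGroup.of s))).prod := by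
  rw [map_list_prod, List.map_map]
  congr 2
  funext ⟨x, b⟩
  cases b <;> simp [letterImage]

/-- This direction needs no injectivity, so it also applies over `ZMod M`. -/
theorem solves_of_isSolution {W : EqWord k}
    (hD : D.letter = fun j => W.getD j (Sum.inr BSGen.a, true)) (hlen : D.len = W.length)
    {g : Fin k → BS 1 n} (hg : W.IsSolution g) :
    D.Solves u (fun i => (BS.toScaleTranslate u hu (g i)).trans)
      (fun i => (BS.toScaleTranslate u hu (g i)).exp) := by
  rw [EqWord.isSolution_iff] at hg
  rw [← D.prod_eq_one_iff (f := fun s => BS.toScaleTranslate u hu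
    (Sum.elim g PresentedGroup.of s)) _ W hD hlen, ← map_letterImage_prod, hg, map_one]
  rintro (i | s)
  · rfl
  · cases s <;> simp only [Sum.elim_inr, BS.toScaleTranslate_of] <;> rfl

theorem isSolution_of_solves {W : EqWord k}
    (hD : D.letter = fun j => W.getD j (Sum.inr BSGen.a, true)) (hlen : D.len = W.length)
    (hinj : Function.Injective (BS.toScaleTranslate u hu)) {p j m : Fin k → ℤ}
    (h : D.Solves u (fun i => (u ^ p i : Rˣ) * (j i : R)) m) :
    W.IsSolution fun i => BS.normalForm n (p i) (j i) (m i) := by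
  rw [EqWord.isSolution_iff]
  apply hinj
  rw [map_one, map_letterImage_prod, D.prod_eq_one_iff _ W hD hlen]
  · exact h
  rintro (i | s)
  · simp only [Sum.elim_inl, BS.toScaleTranslate_normalForm]; rfl
  · cases s <;> simp only [Sum.elim_inr, BS.toScaleTranslate_of] <;> rfl

end QuadraticWord

namespace BS

/-- The exponents seen modulo `M` are those seen over `ℚ`, which lets one solution be read in both
rings. -/
theorem toScaleTranslate_exp_eq {n : ℤ} {R S : Type*} [CommRing R] [CommRing S] (u : Rˣ)
    (hu : (u : R) = n) (v : Sˣ) (hv : (v : S) = n) (g : BS 1 n) :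
    (toScaleTranslate u hu g).exp = (toScaleTranslate v hv g).exp := by
  obtain ⟨p, q, j, rfl⟩ := exists_pow_mul_zpow_mul_pow g
  have e : gt n ^ p * ga n ^ j * (gt n)⁻¹ ^ q = normalForm n (-p) j (q - p) := by
    rw [normalForm, neg_neg, zpow_natCast, inv_pow, ← zpow_natCast _ q, ← zpow_neg]
    congr 2; ring
  rw [e, toScaleTranslate_normalForm, toScaleTranslate_normalForm]

end BS

/-! ### Changing exponents modulo a period -/

namespace QuadraticWord

variable {k : ℕ} (D : QuadraticWord k)

theorem abs_height_le (m : Fin k → ℤ) {l : ℕ} (hl : l ≤ D.len) :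
    |D.height (letterHeight m) l| ≤ D.len + 2 * ∑ i, |m i| := by
  have h1 : |D.height (letterHeight m) l| ≤ ∑ j ∈ Finset.range D.len,
      |letterHeight m (D.letter j).1| := by
    refine (Finset.abs_sum_le_sum_abs _ _).trans ?_
    simp_rw [abs_mul, abs_sign, one_mul]
    exact Finset.sum_le_sum_of_subset_of_nonneg (Finset.range_mono hl) fun _ _ _ => abs_nonneg _
  rw [D.sum_split] at h1
  have h2 : ∑ i, (|letterHeight m (D.letter (D.fst i)).1| + |letterHeight m (D.letter (D.snd i)).1|)
      = 2 * ∑ i, |m i| := by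
    rw [Finset.mul_sum]
    refine Finset.sum_congr rfl fun i _ => ?_
    rw [D.letter_fst, D.letter_snd, letterHeight]; ring
  have h3 : ∑ l ∈ (Finset.range D.len).filter (fun l => (D.letter l).1.isRight),
      |letterHeight m (D.letter l).1| ≤ D.len := by
    have : ∑ l ∈ (Finset.range D.len).filter (fun l => (D.letter l).1.isRight),
        |letterHeight m (D.letter l).1| ≤
        ∑ l ∈ (Finset.range D.len).filter (fun l => (D.letter l).1.isRight), (1 : ℤ) := by
      refine Finset.sum_le_sum fun l hl => ?_
      rw [Finset.mem_filter] at hl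
      rcases e : (D.letter l).1 with i | s
      · simp [e] at hl
      · cases s <;> simp [letterHeight]
    refine this.trans ?_
    rw [Finset.sum_const, nsmul_one]
    have := Finset.card_filter_le (Finset.range D.len) (fun l => (D.letter l).1.isRight)
    rw [Finset.card_range] at this
    exact_mod_cast this
  linarith

theorem dvd_height_sub {τ : ℤ} {m m' : Fin k → ℤ} (h : ∀ i, τ ∣ m' i - m i) (l : ℕ) :
    τ ∣ D.height (letterHeight m') l - D.height (letterHeight m) l := by
  rw [height, height, ← Finset.sum_sub_distrib]
  refine Finset.dvd_sum fun j _ => ?_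
  rw [← mul_sub]
  refine Dvd.dvd.mul_left ?_ _
  rcases (D.letter j).1 with i | s
  · exact h i
  · cases s <;> simp [letterHeight]

section Periodic

variable {R : Type*} [CommRing R] {u : Rˣ} {τ : ℤ} {m m' : Fin k → ℤ}

/-- Heights are integral combinations of the exponents, up to a part fixed by the word; so where `u
^ τ = 1` the linear equation depends only on the exponents modulo `τ`. Used in `ZMod M`, and over
`ℚ` for `n = ±1`. -/
theorem zpow_height_congr (hu : u ^ τ = 1) (h : ∀ i, τ ∣ m' i - m i) (l : ℕ) :
    u ^ D.height (letterHeight m') l = u ^ D.height (letterHeight m) l := by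
  obtain ⟨c, hc⟩ := D.dvd_height_sub h l
  rw [eq_add_of_sub_eq hc, zpow_add, zpow_mul, hu, one_zpow, one_mul]

theorem coeff_congr (hu : u ^ τ = 1) (h : ∀ i, τ ∣ m' i - m i) (i : Fin k) :
    D.coeff u m' i = D.coeff u m i := by
  simp only [coeff, D.zpow_height_congr hu h]

theorem const_congr (hu : u ^ τ = 1) (h : ∀ i, τ ∣ m' i - m i) :
    D.const u m' = D.const u m := by
  simp only [const, D.zpow_height_congr hu h]

end Periodic

/-! ### Integral coefficients -/

/-- The power `n ^ (B + h)` for `h ≥ -B`. -/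
def shiftedPow (n : ℤ) (B : ℕ) (h : ℤ) : ℤ := n ^ (B + h).toNat

/-- The coefficient of the variable `i`, multiplied by `n ^ B`. -/
def intCoeff (n : ℤ) (B : ℕ) (m : Fin k → ℤ) (i : Fin k) : ℤ :=
  D.sign (D.fst i) * shiftedPow n B (D.height (letterHeight m) (D.src (D.fst i)))
    + D.sign (D.snd i) * shiftedPow n B (D.height (letterHeight m) (D.src (D.snd i)))

/-- The constant term, multiplied by `n ^ B`. -/
def intConst (n : ℤ) (B : ℕ) (m : Fin k → ℤ) : ℤ :=
  ∑ l ∈ (Finset.range D.len).filter (fun l => (D.letter l).1 = Sum.inr BSGen.a),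
    D.sign l * shiftedPow n B (D.height (letterHeight m) (D.src l))

section Cast

variable {n : ℤ} {R : Type*} [CommRing R] {u : Rˣ} {B : ℕ} {m : Fin k → ℤ}

theorem cast_shiftedPow (hu : (u : R) = n) {h : ℤ} (hh : |h| ≤ B) :
    ((shiftedPow n B h : ℤ) : R) = (u ^ (B : ℤ) : Rˣ) * (u ^ h : Rˣ) := by
  have h0 : 0 ≤ (B : ℤ) + h := by linarith [(abs_le.mp hh).1]
  rw [← Units.val_mul, ← zpow_add, shiftedPow, Int.cast_pow, ← hu]
  conv_rhs => rw [← Int.toNat_of_nonneg h0]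
  rw [zpow_natCast, Units.val_pow_eq_pow_val]

theorem cast_intCoeff (hu : (u : R) = n)
    (hB : ∀ l ≤ D.len, |D.height (letterHeight m) l| ≤ B) (i : Fin k) :
    ((D.intCoeff n B m i : ℤ) : R) = (u ^ (B : ℤ) : Rˣ) * D.coeff u m i := by
  rw [intCoeff, coeff]
  push_cast
  rw [cast_shiftedPow hu (hB _ (D.src_le (D.fst_lt i))),
    cast_shiftedPow hu (hB _ (D.src_le (D.snd_lt i)))]
  ring

theorem cast_intConst (hu : (u : R) = n)
    (hB : ∀ l ≤ D.len, |D.height (letterHeight m) l| ≤ B) :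
    ((D.intConst n B m : ℤ) : R) = (u ^ (B : ℤ) : Rˣ) * D.const u m := by
  rw [intConst, const, Finset.mul_sum]
  push_cast
  refine Finset.sum_congr rfl fun l hl => ?_
  rw [Finset.mem_filter, Finset.mem_range] at hl
  rw [cast_shiftedPow hu (hB _ (D.src_le hl.1))]
  ring

/-- The equation with denominators cleared. -/
theorem cleared_eq (hu : (u : R) = n)
    (hB : ∀ l ≤ D.len, |D.height (letterHeight m) l| ≤ B) (x : Fin k → R) :
    ∑ i, x i * (D.intCoeff n B m i : R) + (D.intConst n B m : R)
      = (u ^ (B : ℤ) : Rˣ) * (∑ i, x i * D.coeff u m i + D.const u m) := by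
  rw [D.cast_intConst hu hB, mul_add, Finset.mul_sum]
  congr 1
  refine Finset.sum_congr rfl fun i _ => ?_
  rw [D.cast_intCoeff hu hB]
  ring

end Cast

section Bounds

variable {n : ℤ} {B : ℕ} {m : Fin k → ℤ}

theorem abs_shiftedPow_le (hn : n ≠ 0) {h : ℤ} (hh : |h| ≤ B) :
    |shiftedPow n B h| ≤ |n| ^ (2 * B) := by
  rw [shiftedPow, abs_pow]
  apply pow_le_pow_right₀ (Int.one_le_abs hn)
  have := (abs_le.mp hh).2
  omega

theorem abs_intCoeff_le (hn : n ≠ 0) (hB : ∀ l ≤ D.len, |D.height (letterHeight m) l| ≤ B)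
    (i : Fin k) : |D.intCoeff n B m i| ≤ 2 * |n| ^ (2 * B) := by
  refine (abs_add_le _ _).trans ?_
  rw [abs_mul, abs_mul, abs_sign, abs_sign]
  have h1 := abs_shiftedPow_le hn (hB _ (D.src_le (D.fst_lt i)))
  have h2 := abs_shiftedPow_le hn (hB _ (D.src_le (D.snd_lt i)))
  linarith

theorem abs_intConst_le (hn : n ≠ 0) (hB : ∀ l ≤ D.len, |D.height (letterHeight m) l| ≤ B) :
    |D.intConst n B m| ≤ D.len * |n| ^ (2 * B) := by
  refine (Finset.abs_sum_le_sum_abs _ _).trans ?_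
  refine (Finset.sum_le_card_nsmul _ _ (|n| ^ (2 * B)) fun l hl => ?_).trans ?_
  · rw [Finset.mem_filter, Finset.mem_range] at hl
    rw [abs_mul, abs_sign, one_mul]
    exact abs_shiftedPow_le hn (hB _ (D.src_le hl.1))
  · rw [nsmul_eq_mul]
    have := Finset.card_filter_le (Finset.range D.len)
      (fun l => (D.letter l).1 = Sum.inr BSGen.a)
    rw [Finset.card_range] at this
    have h : (((Finset.range D.len).filter
      (fun l => (D.letter l).1 = Sum.inr BSGen.a)).card : ℤ) ≤ D.len := by exact_mod_cast this
    exact mul_le_mul_of_nonneg_right h (by positivity)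

end Bounds

/-- If `n` has period `τ` modulo `M`, where `M` is essentially the coefficient of the variable `i`,
then the exponents of a solution may be changed to any congruent ones modulo `τ`: the translation
parts of the other variables are kept modulo `M`, and the variable `i` compensates. -/
theorem exists_isSolution_of_congr {n : ℤ} (hn : n ≠ 0) {W : EqWord k}
    (hD : D.letter = fun j => W.getD j (Sum.inr BSGen.a, true)) (hlen : D.len = W.length)
    {g : Fin k → BS 1 n} (hg : W.IsSolution g) {u : ℚˣ} (hu : (u : ℚ) = n)
    {M τ : ℕ} (hM : 0 < M) (hτ : 0 < τ) (hper : (M : ℤ) ∣ n ^ τ - 1) {m' : Fin k → ℤ}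
    (hcong : ∀ j, (τ : ℤ) ∣ m' j - (BS.toScaleTranslate u hu (g j)).exp)
    (hclosed : D.height (letterHeight m') D.len = 0) {B : ℕ}
    (hB : D.len + 2 * ∑ j, |m' j| ≤ B) {i : Fin k} {f : ℤ} {e : ℕ}
    (hf : D.intCoeff n B m' i * f = M * n ^ e) (hdvd : (M : ℤ) ∣ D.intCoeff n B m' i)
    (hfn : |f| ≤ |n|) (he : e ≤ 2 * B + 1) {Q : ℕ} (hQ : M ≤ 2 * n.natAbs ^ Q) :
    ∃ g' : Fin k → BS 1 n, W.IsSolution g' ∧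
      BS.tupleSize g' ≤ (n.natAbs + 2) * (k * (Q + 2) + 9 * B + 3) := by
  have hB' : ∀ l ≤ D.len, |D.height (letterHeight m') l| ≤ B :=
    fun l hl => (D.abs_height_le m' hl).trans hB
  have : NeZero M := ⟨hM.ne'⟩
  have hpow : (n : ZMod M) ^ τ = 1 := by
    have := (ZMod.intCast_zmod_eq_zero_iff_dvd (n ^ τ - 1) M).mpr hper
    push_cast at this
    exact sub_eq_zero.mp this
  obtain ⟨v, hv, hvτ⟩ : ∃ v : (ZMod M)ˣ, (v : ZMod M) = n ∧ v ^ (τ : ℤ) = 1 :=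
    ⟨Units.ofPowEqOne _ τ hpow hτ.ne', rfl, by rw [zpow_natCast]; exact Units.ext hpow⟩
  have hsol := (D.solves_of_isSolution v hv hD hlen hg).2
  rw [funext fun j => BS.toScaleTranslate_exp_eq v hv u hu (g j)] at hsol
  set m : Fin k → ℤ := fun j => (BS.toScaleTranslate u hu (g j)).exp
  set x : Fin k → ZMod M := fun j => (BS.toScaleTranslate v hv (g j)).trans
  have hcong' : ∀ j, (τ : ℤ) ∣ m' j - m j := hcong
  simp only [← D.coeff_congr hvτ hcong', ← D.const_congr hvτ hcong'] at hsol
  have hsolZ := D.cleared_eq hv hB' x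
  rw [hsol, mul_zero] at hsolZ
  have hci : ((D.intCoeff n B m' i : ℤ) : ZMod M) = 0 :=
    (ZMod.intCast_zmod_eq_zero_iff_dvd _ M).mpr hdvd
  -- Representatives in `[0, M)` of the given solution modulo `M`. The coefficient of `i` vanishes
  -- there, so the remaining terms `Y` are divisible by `M`.
  let X : Fin k → ℤ := fun j => (x j).val
  have hX : ∀ j, ((X j : ℤ) : ZMod M) = x j := fun j => by simp [X]
  let Y : ℤ := ∑ j ∈ Finset.univ.erase i, X j * D.intCoeff n B m' j + D.intConst n B m'
  have hY : (M : ℤ) ∣ Y := by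
    rw [← ZMod.intCast_zmod_eq_zero_iff_dvd]
    rw [← Finset.sum_erase_add _ _ (Finset.mem_univ i), hci, mul_zero, add_zero] at hsolZ
    simp only [Y]
    push_cast
    simp only [hX]
    exact hsolZ
  obtain ⟨z, hz⟩ := hY
  -- Since the coefficient of `i` times `f` is `M * n ^ e`, the value `-(z * f) * n ^ (-e)`
  -- contributes exactly `-M * z = -Y`.
  let j : Fin k → ℤ := fun l => if l = i then -(z * f) else X l
  let p : Fin k → ℤ := fun l => if l = i then -(e : ℤ) else 0
  have hnQ : (n : ℚ) ≠ 0 := by exact_mod_cast hn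
  have hmain : D.Solves u (fun l => (u ^ p l : ℚˣ) * (j l : ℚ)) m' := by
    refine ⟨hclosed, ?_⟩
    have h1 := D.cleared_eq hu hB' (fun l => (u ^ p l : ℚˣ) * (j l : ℚ))
    rw [← Finset.sum_erase_add _ _ (Finset.mem_univ i)] at h1
    have h2 : ∑ l ∈ Finset.univ.erase i, ((u ^ p l : ℚˣ) : ℚ) * (j l : ℚ)
        * (D.intCoeff n B m' l : ℚ) = ((∑ l ∈ Finset.univ.erase i, X l * D.intCoeff n B m' l : ℤ) : ℚ) := by
      push_cast
      refine Finset.sum_congr rfl fun l hl => ?_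
      have : l ≠ i := (Finset.mem_erase.mp hl).1
      simp [p, j, this]
    have h3 : ((u ^ p i : ℚˣ) : ℚ) * (j i : ℚ) * (D.intCoeff n B m' i : ℚ) = -(M * z : ℤ) := by
      have hf' : (D.intCoeff n B m' i : ℚ) * f = M * n ^ e := by exact_mod_cast hf
      simp only [p, j, if_true, zpow_neg, zpow_natCast, Units.val_inv_eq_inv_val,
        Units.val_pow_eq_pow_val, hu]
      push_cast
      field_simp
      linear_combination (-(z : ℚ)) * hf'
    rw [h2, h3, ← hz] at h1
    have hYc : (Y : ℚ) = ((∑ l ∈ Finset.univ.erase i, X l * D.intCoeff n B m' l : ℤ) : ℚ)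
        + (D.intConst n B m' : ℚ) := Int.cast_add _ _
    have h4 : ((u ^ (B : ℤ) : ℚˣ) : ℚ) * (∑ l, ((u ^ p l : ℚˣ) : ℚ) * (j l : ℚ) * D.coeff u m' l
        + D.const u m') = 0 := by
      rw [← h1, hYc]; ring
    exact (Units.mul_right_eq_zero _).mp h4
  refine ⟨_, D.isSolution_of_solves u hu hD hlen (BS.toScaleTranslate_injective u hu) hmain, ?_⟩
  have hkL := D.two_mul_card_le
  have hsumnn : 0 ≤ ∑ j, |m' j| := Finset.sum_nonneg fun _ _ => abs_nonneg _
  have hXb : ∀ l, |X l| ≤ M := fun l => by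
    have h := (ZMod.val_lt (x l)).le
    change |((x l).val : ℤ)| ≤ M
    rw [Nat.abs_cast]
    exact_mod_cast h
  -- `|Y|` is at most `(2 * k * M + D.len) * |n| ^ (2 * B)`. Dividing by `M ≥ 1` and using `2 * k ≤
  -- D.len` removes the dependence on `M`.
  have hzb : |z| ≤ 2 * D.len * |n| ^ (2 * B) := by
    have hM' : (1 : ℤ) ≤ M := by exact_mod_cast hM
    set N : ℤ := |n| ^ (2 * B) with hN
    have hN0 : 0 ≤ N := by positivity
    have h1 : |Y| ≤ (k * M * 2 + D.len) * N := by
      refine (abs_add_le _ _).trans ?_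
      rw [add_mul]
      refine add_le_add ?_ (D.abs_intConst_le hn hB')
      refine (Finset.abs_sum_le_sum_abs _ _).trans ?_
      refine (Finset.sum_le_sum_of_subset_of_nonneg (Finset.erase_subset _ _)
        fun _ _ _ => abs_nonneg _).trans ?_
      refine (Finset.sum_le_card_nsmul _ _ (M * (2 * N)) fun l _ => ?_).trans ?_
      · rw [abs_mul]
        exact mul_le_mul (hXb l) (D.abs_intCoeff_le hn hB' l) (abs_nonneg _) (by positivity)
      · simp only [Finset.card_univ, Fintype.card_fin, nsmul_eq_mul]
        apply le_of_eq; ring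
    rw [hz, abs_mul, abs_of_nonneg (by positivity : (0 : ℤ) ≤ M)] at h1
    have h2 : (k * M * 2 + D.len) * N ≤ M * (2 * D.len * N) := by
      have h3 : (2 * k : ℤ) ≤ D.len := by exact_mod_cast hkL
      have h4 : (k * M * 2 + D.len : ℤ) ≤ M * (2 * D.len) := by nlinarith
      nlinarith
    exact le_of_mul_le_mul_left (h1.trans h2) (by linarith)
  have hsize : ∀ l, BS.wordLength (BS.normalForm n (p l) (j l) (m' l)) ≤
      (m' l).natAbs + (n.natAbs + 2) * (Q + 2) + if l = i then
        2 * (2 * B + 1) + (n.natAbs + 2) * (2 * B + 1 + 2 * D.len) else 0 := by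
    intro l
    have h1 := BS.wordLength_normalForm_le (n := n) (p l) (j l) (m' l)
    by_cases hl : l = i
    · have h2 : BS.wordLength (BS.ga n ^ j l) ≤ (n.natAbs + 2) * (2 * B + 1 + 2 * D.len) := by
        apply BS.wordLength_ga_zpow_le_of_le hn
        have : |z * f| ≤ 2 * D.len * |n| ^ (2 * B + 1) := by
          rw [abs_mul, pow_succ, ← mul_assoc]
          exact mul_le_mul hzb hfn (abs_nonneg _) (by positivity)
        simp only [j, hl, if_true, Int.natAbs_neg]
        zify
        exact this
      simp only [p, hl, if_true, Int.natAbs_neg, Int.natAbs_natCast] at h1 h2 ⊢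
      omega
    · have h2 : BS.wordLength (BS.ga n ^ j l) ≤ (n.natAbs + 2) * (Q + 2) := by
        apply BS.wordLength_ga_zpow_le_of_le hn
        simp only [j, hl, if_false]
        refine le_trans ?_ hQ
        zify
        exact hXb l
      simp only [p, hl, if_false, Int.natAbs_zero] at h1 ⊢
      omega
  have htotal : BS.tupleSize (fun l => BS.normalForm n (p l) (j l) (m' l)) ≤
      ∑ l, (m' l).natAbs + k * ((n.natAbs + 2) * (Q + 2)) +
        (2 * (2 * B + 1) + (n.natAbs + 2) * (2 * B + 1 + 2 * D.len)) := by
    refine (Finset.sum_le_sum fun l _ => hsize l).trans ?_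
    simp [Finset.sum_add_distrib]
  refine htotal.trans ?_
  have hnat : D.len + 2 * ∑ l, (m' l).natAbs ≤ B := by
    zify; exact hB
  have hc : 2 ≤ n.natAbs + 2 := by omega
  generalize n.natAbs + 2 = c at hc ⊢
  generalize ∑ l, (m' l).natAbs = A at hnat ⊢
  have h1 : A + 2 * (2 * B + 1) ≤ c * (5 * B + 2) := by nlinarith
  have h2 : c * (2 * B + 1 + 2 * D.len) ≤ c * (4 * B + 1) := by
    apply Nat.mul_le_mul_left; omega
  have h3 : c * (k * (Q + 2) + 9 * B + 3)
    = k * (c * (Q + 2)) + c * (5 * B + 2) + c * (4 * B + 1) := by ring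
  omega

end QuadraticWord

/-! ### Vanishing coefficients: lowering the heights -/

namespace QuadraticWord

variable {k : ℕ} (D : QuadraticWord k)

theorem height_tgt (m : Fin k → ℤ) {l : ℕ} {i : Fin k} (hl : (D.letter l).1 = Sum.inl i) :
    D.height (letterHeight m) (D.tgt l) = D.height (letterHeight m) (D.src l) + m i := by
  have h := D.height_succ (letterHeight m) l
  rw [hl, letterHeight] at h
  rcases D.src_cases l with ⟨h1, h2, h3⟩ | ⟨h1, h2, h3⟩ <;> rw [h2, h3, h, h1] <;> ring

/-- Two signed powers of `n` cancel only if their absolute values agree, and powers of `|n| ≥ 2` are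
distinct. -/
theorem zpow_height_eq_of_coeff_eq_zero {n : ℤ} (hn : 2 ≤ |n|) {u : ℚˣ} (hu : (u : ℚ) = n)
    {m : Fin k → ℤ} {i : Fin k} (h : D.coeff u m i = 0) :
    D.height (letterHeight m) (D.src (D.fst i)) = D.height (letterHeight m) (D.src (D.snd i)) := by
  have hn' : (2 : ℚ) ≤ |(n : ℚ)| := by exact_mod_cast hn
  have habs : ∀ l, |(D.sign l : ℚ)| = 1 := fun l => by exact_mod_cast D.abs_sign l
  rw [coeff, add_eq_zero_iff_eq_neg] at h
  have h1 := congrArg abs h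
  rw [abs_neg, abs_mul, abs_mul, habs, habs, one_mul, one_mul, Units.val_zpow_eq_zpow_val,
    Units.val_zpow_eq_zpow_val, hu, abs_zpow, abs_zpow] at h1
  exact zpow_right_injective₀ (by linarith) (by linarith) h1

/-- Heights `h` of the vertices of a closed path labelled by the word, for which the constant term
vanishes and the two occurrences of each variable connect the same heights. -/
structure IsProfile (n : ℤ) (h : ℕ → ℕ) : Prop where
  closed : h D.len = h 0
  step : ∀ l < D.len, ∀ s, (D.letter l).1 = Sum.inr s →
    (h (l + 1) : ℤ) = h l + D.sign l * letterHeight (k := k) 0 (Sum.inr s)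
  src_eq : ∀ i, h (D.src (D.fst i)) = h (D.src (D.snd i))
  tgt_eq : ∀ i, h (D.tgt (D.fst i)) = h (D.tgt (D.snd i))
  sum_eq : ∑ l ∈ (Finset.range D.len).filter (fun l => (D.letter l).1 = Sum.inr BSGen.a),
    D.sign l * n ^ h (D.src l) = 0

variable {D}

theorem IsProfile.abs_step_le {n : ℤ} {h : ℕ → ℕ} (hh : D.IsProfile n h) {l : ℕ}
    (hl : l < D.len) {s : BSGen} (hs : (D.letter l).1 = Sum.inr s) :
    |(h (l + 1) : ℤ) - h l| ≤ 1 := by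
  rw [hh.step l hl s hs, add_sub_cancel_left, abs_mul, abs_sign, one_mul]
  cases s <;> simp [letterHeight]

/-- An interval of heights that is long enough and is not attained can be shortened. -/
theorem IsProfile.contract {n : ℤ} (hn : 2 ≤ |n|) {h : ℕ → ℕ} (hh : D.IsProfile n h) {x y : ℕ}
    (hxy : x + (D.len + 1) ≤ y) (hgap : ∀ l ≤ D.len, h l < x ∨ y ≤ h l) :
    D.IsProfile n (fun l => if h l < x then h l else h l - 1) where
  closed := by simp only [hh.closed]
  step := by
    intro l hl s hs
    have h1 := hh.step l hl s hs
    have h2 := abs_le.mp (hh.abs_step_le hl hs)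
    have h3 := hgap l hl.le
    have h4 := hgap (l + 1) hl
    split_ifs <;> omega
  src_eq i := by simp only [hh.src_eq i]
  tgt_eq i := by simp only [hh.tgt_eq i]
  sum_eq := by
    set S := (Finset.range D.len).filter (fun l => (D.letter l).1 = Sum.inr BSGen.a) with hS
    have hmem : ∀ l ∈ S, D.src l ≤ D.len := fun l hl => by
      rw [hS, Finset.mem_filter, Finset.mem_range] at hl
      exact D.src_le hl.1
    have hsum := hh.sum_eq
    rw [← hS, ← Finset.sum_filter_add_sum_filter_not S (fun l => h (D.src l) < x)] at hsum
    set low := ∑ l ∈ S.filter (fun l => h (D.src l) < x), D.sign l * n ^ h (D.src l) with hlow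
    set high := ∑ l ∈ S.filter (fun l => ¬ h (D.src l) < x), D.sign l * n ^ h (D.src l) with hhigh
    -- The high terms are divisible by `n ^ y`, hence so is the sum of the low ones; but that sum is
    -- at most `D.len * |n| ^ x < |n| ^ y`. So both sums vanish, and the high one may be divided by
    -- `n`.
    have hdvd : n ^ y ∣ high := by
      refine Finset.dvd_sum fun l hl => Dvd.dvd.mul_left (pow_dvd_pow _ ?_) _
      rw [Finset.mem_filter] at hl
      exact (hgap _ (hmem l hl.1)).resolve_left hl.2
    have hlow_dvd : n ^ y ∣ low := by
      rw [eq_neg_of_add_eq_zero_left hsum]; exact (dvd_neg).mpr hdvd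
    have hn0 : (1 : ℤ) ≤ |n| := by linarith
    have hlow_abs : |low| < |n ^ y| := by
      have h1 : |low| ≤ D.len * |n| ^ x := by
        refine (Finset.abs_sum_le_sum_abs _ _).trans ?_
        refine (Finset.sum_le_card_nsmul _ _ (|n| ^ x) fun l hl => ?_).trans ?_
        · rw [abs_mul, abs_sign, one_mul, abs_pow]
          exact pow_le_pow_right₀ hn0 (Finset.mem_filter.mp hl).2.le
        · rw [nsmul_eq_mul]
          have h2 : (S.filter fun l => h (D.src l) < x).card ≤ D.len := by
            refine (Finset.card_filter_le _ _).trans ?_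
            refine (Finset.card_filter_le _ _).trans ?_
            rw [Finset.card_range]
          exact mul_le_mul_of_nonneg_right (by exact_mod_cast h2) (by positivity)
      have h3 : (D.len : ℤ) < |n| ^ (D.len + 1) := by
        have h4 : (D.len : ℤ) < 2 ^ (D.len + 1) := by
          exact_mod_cast (Nat.lt_succ_self _).trans Nat.lt_two_pow_self
        exact h4.trans_le (pow_le_pow_left₀ (by norm_num) hn _)
      calc |low| ≤ D.len * |n| ^ x := h1
        _ < |n| ^ (D.len + 1) * |n| ^ x := mul_lt_mul_of_pos_right h3 (by positivity)
        _ = |n| ^ (x + (D.len + 1)) := by rw [← pow_add, add_comm]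
        _ ≤ |n| ^ y := pow_le_pow_right₀ hn0 hxy
        _ = |n ^ y| := (abs_pow _ _).symm
    have hlow0 : low = 0 := Int.eq_zero_of_abs_lt_dvd ((abs_dvd _ _).mpr hlow_dvd) hlow_abs
    have hhigh0 : high = 0 := by rw [hlow0, zero_add] at hsum; exact hsum
    rw [← Finset.sum_filter_add_sum_filter_not S (fun l => h (D.src l) < x)]
    have e1 : ∑ l ∈ S.filter (fun l => h (D.src l) < x),
        D.sign l * n ^ (if h (D.src l) < x then h (D.src l) else h (D.src l) - 1) = low := by
      refine Finset.sum_congr rfl fun l hl => ?_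
      rw [if_pos (Finset.mem_filter.mp hl).2]
    have e2 : n * ∑ l ∈ S.filter (fun l => ¬ h (D.src l) < x),
        D.sign l * n ^ (if h (D.src l) < x then h (D.src l) else h (D.src l) - 1) = high := by
      rw [Finset.mul_sum]
      refine Finset.sum_congr rfl fun l hl => ?_
      rw [Finset.mem_filter] at hl
      have h1 := (hgap _ (hmem l hl.1)).resolve_left hl.2
      rw [if_neg hl.2, mul_left_comm, mul_pow_sub_one (by omega)]
    rw [hhigh0] at e2
    have hn1 : n ≠ 0 := by rintro rfl; simp at hn
    rw [e1, hlow0, (mul_eq_zero.mp e2).resolve_left hn1, add_zero]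

/-- The `D.len + 1` vertices cannot meet all of the first `D.len + 2` blocks of `D.len + 1` heights.
If some height lies above these blocks, contracting an empty one lowers the total height, on which
the induction runs. -/
theorem IsProfile.exists_bounded {n : ℤ} (hn : 2 ≤ |n|) {h : ℕ → ℕ} (hh : D.IsProfile n h) :
    ∃ h', D.IsProfile n h' ∧ ∀ l ≤ D.len, h' l < (D.len + 2) * (D.len + 1) := by
  induction hw : ∑ l ∈ Finset.range (D.len + 1), h l using Nat.strong_induction_on generalizing h
    with
  | _ w ih =>
    by_cases hb : ∀ l ≤ D.len, h l < (D.len + 2) * (D.len + 1)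
    · exact ⟨h, hh, hb⟩
    push Not at hb
    obtain ⟨l₀, hl₀, hbig⟩ := hb
    obtain ⟨j, hj, hj'⟩ := Finset.exists_mem_notMem_of_card_lt_card
      (s := (Finset.range (D.len + 1)).image fun l => h l / (D.len + 1))
      (t := Finset.range (D.len + 2))
      (by
        refine Finset.card_image_le.trans_lt ?_
        simp)
    rw [Finset.mem_range] at hj
    have hgap : ∀ l ≤ D.len, h l < j * (D.len + 1) ∨ (j + 1) * (D.len + 1) ≤ h l := by
      intro l hl
      have h1 : h l / (D.len + 1) ≠ j := fun e => hj' <| Finset.mem_image.mpr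
        ⟨l, Finset.mem_range.mpr (Nat.lt_succ_of_le hl), e⟩
      rcases lt_or_gt_of_ne h1 with h2 | h2
      · exact Or.inl ((Nat.div_lt_iff_lt_mul (Nat.succ_pos _)).mp h2)
      · exact Or.inr ((Nat.le_div_iff_mul_le (Nat.succ_pos _)).mp h2)
    refine ih _ ?_ (hh.contract hn (x := j * (D.len + 1)) (y := (j + 1) * (D.len + 1))
      (by ring_nf; rfl) hgap) rfl
    rw [← hw]
    have hle : j * (D.len + 1) ≤ h l₀ := by
      refine le_trans ?_ hbig
      exact Nat.mul_le_mul_right _ (by omega)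
    have hpos : 0 < h l₀ := lt_of_lt_of_le (by positivity) hbig
    refine Finset.sum_lt_sum (fun l _ => by split_ifs <;> omega) ⟨l₀, ?_, ?_⟩
    · exact Finset.mem_range.mpr (Nat.lt_succ_of_le hl₀)
    · rw [if_neg (by omega)]; omega

variable (D)

/-- If all coefficients vanish, there is a solution consisting of small powers of `t`. -/
theorem exists_isSolution_of_coeff_eq_zero {n : ℤ} (hn : 2 ≤ |n|) {W : EqWord k}
    (hD : D.letter = fun j => W.getD j (Sum.inr BSGen.a, true)) (hlen : D.len = W.length)
    {u : ℚˣ} (hu : (u : ℚ) = n) {x : Fin k → ℚ} {m : Fin k → ℤ} (hsol : D.Solves u x m)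
    (hc : ∀ i, D.coeff u m i = 0) :
    ∃ g' : Fin k → BS 1 n, W.IsSolution g' ∧
      BS.tupleSize g' ≤ k * ((D.len + 2) * (D.len + 1)) := by
  obtain ⟨B, hB⟩ : ∃ B : ℕ, D.len + 2 * ∑ i, |m i| = B :=
    Int.eq_ofNat_of_zero_le (by positivity)
  have hB' : ∀ l ≤ D.len, |D.height (letterHeight m) l| ≤ B :=
    fun l hl => (D.abs_height_le m hl).trans_eq hB
  have hsrc := fun i => D.zpow_height_eq_of_coeff_eq_zero hn hu (hc i)
  have hconst : D.const u m = 0 := by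
    have := hsol.2
    simpa [hc] using this
  have hprof : D.IsProfile n fun l => (B + D.height (letterHeight m) l).toNat := by
    refine ⟨?_, ?_, ?_, ?_, ?_⟩
    · simp only [hsol.1]; simp [height]
    · intro l hl s hs
      have h1 := abs_le.mp (hB' l hl.le)
      have h2 := abs_le.mp (hB' (l + 1) hl)
      have h3 := D.height_succ (letterHeight m) l
      rw [hs] at h3
      have h4 : letterHeight m (Sum.inr s) = letterHeight (k := k) 0 (Sum.inr s) := by
        cases s <;> rfl
      rw [h4] at h3
      omega
    · intro i; simp only [hsrc i]
    · intro i
      simp only [D.height_tgt m (D.letter_fst i), D.height_tgt m (D.letter_snd i), hsrc i]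
    · have := D.cast_intConst hu hB'
      rw [hconst, mul_zero] at this
      exact_mod_cast this
  obtain ⟨h, hh, hbound⟩ := hprof.exists_bounded hn
  -- The exponents are read off the profile. They do not depend on the occurrence used, since both
  -- connect the same heights.
  let m' : Fin k → ℤ := fun i => (h (D.tgt (D.fst i)) : ℤ) - h (D.src (D.fst i))
  have hheight : ∀ l ≤ D.len, D.height (letterHeight m') l = (h l : ℤ) - h 0 := by
    intro l hl
    induction l with
    | zero => simp [height]
    | succ l ih =>
      rw [D.height_succ, ih (by omega)]
      rcases e : (D.letter l).1 with i | s
      · have h1 : letterHeight m' (Sum.inl i) = (h (D.tgt l) : ℤ) - h (D.src l) := by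
          rcases D.eq_or_eq l hl i e with h2 | h2
          · rw [h2]; rfl
          · rw [h2, ← hh.src_eq, ← hh.tgt_eq]; rfl
        rw [h1]
        rcases D.src_cases l with ⟨h1, h2, h3⟩ | ⟨h1, h2, h3⟩ <;> rw [h2, h3, h1] <;> ring
      · rw [hh.step l hl s e]
        have h4 : letterHeight m' (Sum.inr s) = letterHeight (k := k) 0 (Sum.inr s) := by
          cases s <;> rfl
        rw [h4]; ring
  have hsolves : D.Solves u (fun i => (u ^ (0 : ℤ) : ℚˣ) * ((0 : ℤ) : ℚ)) m' := by
    refine ⟨by rw [hheight _ le_rfl, hh.closed, sub_self], ?_⟩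
    have hconst' : D.const u m' = 0 := by
      have e := congrArg (fun z : ℤ => ((u ^ (-(h 0 : ℤ)) : ℚˣ) : ℚ) * (z : ℚ)) hh.sum_eq
      simp only [Int.cast_zero, mul_zero] at e
      rw [const, ← e, Int.cast_sum, Finset.mul_sum]
      refine Finset.sum_congr rfl fun l hl => ?_
      rw [Finset.mem_filter, Finset.mem_range] at hl
      rw [hheight _ (D.src_le hl.1), sub_eq_add_neg, zpow_add, Units.val_mul, zpow_natCast,
        Units.val_pow_eq_pow_val, hu]
      push_cast
      ring
    simp [hconst']
  refine ⟨_, D.isSolution_of_solves u hu hD hlen (BS.toScaleTranslate_injective u hu) hsolves, ?_⟩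
  refine (Finset.sum_le_card_nsmul _ _ ((D.len + 2) * (D.len + 1)) fun i _ => ?_).trans_eq (by simp)
  have h1 := BS.wordLength_normalForm_le (n := n) 0 0 (m' i)
  rw [zpow_zero, BS.wordLength_one] at h1
  have h2 := hbound _ (D.tgt_le (D.fst_lt i))
  have h3 := hbound _ (D.src_le (D.fst_lt i))
  simp only [Int.natAbs_zero] at h1
  have h4 : (m' i).natAbs ≤ (D.len + 2) * (D.len + 1) := by
    simp only [m']
    omega
  exact h1.trans (by omega)

end QuadraticWord

/-! ### Closed changes of exponents and their effect on the gaps -/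

namespace QuadraticWord

variable {k : ℕ} (D : QuadraticWord k)

/-- The heights of the letters when the variables have exponents `μ` and the generators have
exponent `0`. -/
def varHeight (μ : Fin k → ℤ) : Fin k ⊕ BSGen → ℤ := Sum.elim μ 0

theorem letterHeight_add (m μ : Fin k → ℤ) :
    letterHeight (m + μ) = letterHeight m + varHeight μ := by
  funext s
  rcases s with i | s
  · rfl
  · cases s <;> simp [letterHeight, varHeight]

/-- The total exponent of the occurrences of the variable `j` before the vertex `l`. -/
def passed (j : Fin k) (l : ℕ) : ℤ :=
  (if D.fst j < l then D.sign (D.fst j) else 0) + (if D.snd j < l then D.sign (D.snd j) else 0)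

/-- The total exponent of the variable `j` in the word. -/
def weight (j : Fin k) : ℤ := D.sign (D.fst j) + D.sign (D.snd j)

theorem height_varHeight (μ : Fin k → ℤ) {l : ℕ} (hl : l ≤ D.len) :
    D.height (varHeight μ) l = ∑ j, D.passed j l * μ j := by
  have h1 : D.height (varHeight μ) l = ∑ j ∈ Finset.range D.len,
      if j < l then D.sign j * varHeight μ (D.letter j).1 else 0 := by
    rw [height, ← Finset.sum_filter]
    refine Finset.sum_congr ?_ fun _ _ => rfl
    ext j
    simp only [Finset.mem_range, Finset.mem_filter]
    omega
  rw [h1, D.sum_split, Finset.sum_eq_zero (s := Finset.filter _ _), add_zero]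
  · refine Finset.sum_congr rfl fun j _ => ?_
    rw [D.letter_fst, D.letter_snd, passed, varHeight, Sum.elim_inl]
    split_ifs <;> ring
  · intro l hl
    rw [Finset.mem_filter] at hl
    rcases e : (D.letter l).1 with i | s
    · simp [e] at hl
    · simp [varHeight]

theorem height_varHeight_len (μ : Fin k → ℤ) :
    D.height (varHeight μ) D.len = ∑ j, D.weight j * μ j := by
  rw [D.height_varHeight μ le_rfl]
  refine Finset.sum_congr rfl fun j _ => ?_
  rw [passed, if_pos (D.fst_lt j), if_pos (D.snd_lt j), weight]

theorem height_add_len (m μ : Fin k → ℤ) :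
    D.height (letterHeight (m + μ)) D.len
      = D.height (letterHeight m) D.len + ∑ j, D.weight j * μ j := by
  rw [letterHeight_add, D.height_add, D.height_varHeight_len]

/-- Weight 0 means that the variable occurs once with each sign (an orientable variable); otherwise
both occurrences have the same sign (a nonorientable one). -/
theorem weight_eq (j : Fin k) :
    (D.weight j = 0 ∧ D.sign (D.snd j) = -D.sign (D.fst j)) ∨
      (D.weight j = 2 * D.sign (D.fst j) ∧ D.sign (D.snd j) = D.sign (D.fst j)) := by
  rw [weight]
  rcases D.sign_eq (D.fst j) with h | h <;> rcases D.sign_eq (D.snd j) with h' | h' <;>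
    rw [h, h'] <;> simp

/-- The exponents can be reduced modulo `τ` without opening the path. -/
theorem exists_small_congr {m : Fin k → ℤ} (hm : D.height (letterHeight m) D.len = 0) {τ : ℕ}
    (hτ : 0 < τ) :
    ∃ m' : Fin k → ℤ, D.height (letterHeight m') D.len = 0 ∧ (∀ j, (τ : ℤ) ∣ m' j - m j) ∧
      ∑ j, |m' j| ≤ D.len + D.len * τ := by
  have hτ' : (0 : ℤ) < τ := by exact_mod_cast hτ
  have hk : (2 * k : ℤ) ≤ D.len := by exact_mod_cast D.two_mul_card_le
  have hr : ∀ j, |m j % τ| ≤ τ := fun j => by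
    rw [abs_of_nonneg (Int.emod_nonneg _ hτ'.ne')]
    exact (Int.emod_lt_of_pos _ hτ').le
  have hd : ∀ j, (τ : ℤ) ∣ m j % τ - m j := fun j => by
    rw [← neg_sub, dvd_neg]; exact Int.dvd_self_sub_emod
  by_cases hall : ∀ j, D.weight j = 0
  · refine ⟨fun j => m j % τ, ?_, hd, ?_⟩
    · have := D.height_add_len m ((fun j => m j % τ) - m)
      rw [add_sub_cancel, hm] at this
      simpa [hall] using this
    · refine (Finset.sum_le_card_nsmul _ _ (τ : ℤ) fun j _ => hr j).trans ?_
      simp only [Finset.card_univ, Fintype.card_fin, nsmul_eq_mul]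
      nlinarith
  · push Not at hall
    obtain ⟨v, hv⟩ := hall
    have hη : ∀ j, ∃ η : ℤ, D.weight j = 2 * η ∧ |η| ≤ 1 := fun j => by
      rcases D.weight_eq j with h | h
      · exact ⟨0, by rw [h.1]; ring, by simp⟩
      · exact ⟨_, h.1, (D.abs_sign _).le⟩
    choose η hη hη1 using hη
    have hv2 : η v * η v = 1 := by
      have h1 := hη1 v
      have h2 := hη v
      have h3 : η v = 1 ∨ η v = -1 := by rw [abs_le] at h1; omega
      rcases h3 with h3 | h3 <;> rw [h3] <;> norm_num
    -- All weights are even, so one nonorientable variable `v` can absorb the reduction of all the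
    -- others, and its change `η v * S` is again a multiple of `τ`.
    let S : ℤ := ∑ j ∈ Finset.univ.erase v, η j * (m j - m j % τ)
    let μ : Fin k → ℤ := fun j => if j = v then η v * S else m j % τ - m j
    have hsum : ∑ j, D.weight j * μ j = 0 := by
      rw [← Finset.sum_erase_add _ _ (Finset.mem_univ v)]
      have e1 : ∑ j ∈ Finset.univ.erase v, D.weight j * μ j = -2 * S := by
        simp only [S]
        rw [Finset.mul_sum]
        refine Finset.sum_congr rfl fun j hj => ?_
        simp only [μ, if_neg (Finset.mem_erase.mp hj).1, hη]
        ring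
      have e2 : D.weight v * μ v = 2 * S := by
        simp only [μ, if_true, hη]
        linear_combination 2 * S * hv2
      rw [e1, e2]; ring
    have hclosed : D.height (letterHeight (m + μ)) D.len = 0 := by
      rw [D.height_add_len, hm, hsum, add_zero]
    have hval : ∀ j, j ≠ v → (m + μ) j = m j % τ := fun j hj => by
      simp [μ, hj]
    refine ⟨m + μ, hclosed, ?_, ?_⟩
    · intro j
      rw [Pi.add_apply, add_sub_cancel_left]
      by_cases hj : j = v
      · simp only [μ, hj, if_true]
        refine Dvd.dvd.mul_left (Finset.dvd_sum fun j _ => Dvd.dvd.mul_left ?_ _) _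
        exact Int.dvd_self_sub_emod
      · simp only [μ, hj, if_false]; exact hd j
    · have hrest : ∑ j ∈ Finset.univ.erase v, |(m + μ) j| ≤ k * τ := by
        refine (Finset.sum_le_card_nsmul _ _ (τ : ℤ) fun j hj => ?_).trans ?_
        · rw [hval j (Finset.mem_erase.mp hj).1]; exact hr j
        · rw [nsmul_eq_mul]
          refine mul_le_mul_of_nonneg_right ?_ hτ'.le
          have := Finset.card_le_univ (Finset.univ.erase v)
          rw [Fintype.card_fin] at this
          exact_mod_cast this
      -- The new exponent of `v` is not a residue; it is bounded because the path is closed, through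
      -- the contributions of the other variables and the constants.
      have h0 := D.height_add_len 0 (m + μ)
      rw [zero_add, hclosed, ← Finset.sum_erase_add _ _ (Finset.mem_univ v)] at h0
      have h1 : |D.height (letterHeight (0 : Fin k → ℤ)) D.len| ≤ D.len := by
        simpa using D.abs_height_le 0 le_rfl
      have h2 : |∑ j ∈ Finset.univ.erase v, D.weight j * (m + μ) j| ≤ 2 * (k * τ) := by
        refine (Finset.abs_sum_le_sum_abs _ _).trans ?_
        refine le_trans ?_ (mul_le_mul_of_nonneg_left hrest (by norm_num))
        rw [Finset.mul_sum]
        refine Finset.sum_le_sum fun j _ => ?_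
        rw [abs_mul, hη, abs_mul]
        refine mul_le_mul_of_nonneg_right ?_ (abs_nonneg _)
        have := hη1 j
        norm_num
        linarith
      have h3 : |D.weight v * (m + μ) v| = 2 * |(m + μ) v| := by
        have h4 : |η v| = 1 := by
          have := congrArg abs hv2
          rw [abs_mul, abs_one] at this
          nlinarith [abs_nonneg (η v)]
        rw [hη, abs_mul, abs_mul, h4]; norm_num
      have h5 : |D.weight v * (m + μ) v| ≤ D.len + 2 * (k * τ) := by
        rw [abs_le] at h1 h2 ⊢
        constructor <;> linarith
      rw [← Finset.sum_erase_add _ _ (Finset.mem_univ v)]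
      have hkτ : (2 * k * τ : ℤ) ≤ D.len * τ := mul_le_mul_of_nonneg_right hk hτ'.le
      have h6 : 0 ≤ (D.len : ℤ) := by positivity
      linarith

/-- The difference of the heights of the two occurrences of the variable `i`. -/
def gap (f : Fin k ⊕ BSGen → ℤ) (i : Fin k) : ℤ :=
  D.height f (D.src (D.snd i)) - D.height f (D.src (D.fst i))

/-- The coefficient of the exponent of the variable `j` in the gap of the variable `i`. -/
def crossing (i j : Fin k) : ℤ :=
  D.passed j (D.src (D.snd i)) - D.passed j (D.src (D.fst i))

theorem gap_varHeight (μ : Fin k → ℤ) (i : Fin k) :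
    D.gap (varHeight μ) i = ∑ j, D.crossing i j * μ j := by
  rw [gap, D.height_varHeight _ (D.src_le (D.snd_lt i)),
    D.height_varHeight _ (D.src_le (D.fst_lt i)), ← Finset.sum_sub_distrib]
  simp only [crossing, sub_mul]

theorem gap_add (m μ : Fin k → ℤ) (i : Fin k) :
    D.gap (letterHeight (m + μ)) i = D.gap (letterHeight m) i + D.gap (varHeight μ) i := by
  simp only [gap, letterHeight_add, D.height_add]; ring

theorem gap_smul (c : ℤ) (μ : Fin k → ℤ) (i : Fin k) :
    D.gap (varHeight (c • μ)) i = c * D.gap (varHeight μ) i := by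
  simp only [gap_varHeight, Finset.mul_sum, Pi.smul_apply, smul_eq_mul]
  exact Finset.sum_congr rfl fun _ _ => by ring

theorem abs_gap_le (m : Fin k → ℤ) (i : Fin k) :
    |D.gap (letterHeight m) i| ≤ 2 * (D.len + 2 * ∑ j, |m j|) := by
  refine (abs_sub _ _).trans ?_
  have h1 := D.abs_height_le m (D.src_le (D.snd_lt i))
  have h2 := D.abs_height_le m (D.src_le (D.fst_lt i))
  linarith

theorem crossing_self (i : Fin k) :
    (D.weight i = 0 → D.crossing i i = 0) ∧
      (D.weight i ≠ 0 → D.crossing i i = D.sign (D.fst i)) := by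
  have h := D.fst_lt_snd i
  rcases D.src_cases (D.fst i) with ⟨h1, h2, -⟩ | ⟨h1, h2, -⟩ <;>
    rcases D.src_cases (D.snd i) with ⟨h3, h4, -⟩ | ⟨h3, h4, -⟩ <;>
    (simp only [weight, crossing, passed, h1, h2, h3, h4]; constructor <;> intro <;>
      split_ifs <;> omega)

/-- Only occurrences of `j` strictly between those of `i` count: the shift by one in `src` passes
over a letter of `i` itself. -/
theorem crossing_of_ne {i j : Fin k} (hij : i ≠ j) :
    D.crossing i j = (if D.fst i < D.fst j ∧ D.fst j < D.snd i then D.sign (D.fst j) else 0)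
      + (if D.fst i < D.snd j ∧ D.snd j < D.snd i then D.sign (D.snd j) else 0) := by
  have hne : ∀ a b, (D.letter a).1 = Sum.inl i → (D.letter b).1 = Sum.inl j → a ≠ b := by
    rintro a _ ha hb rfl
    exact hij (Sum.inl_injective (ha.symm.trans hb))
  have e1 := hne _ _ (D.letter_fst i) (D.letter_fst j)
  have e2 := hne _ _ (D.letter_fst i) (D.letter_snd j)
  have e3 := hne _ _ (D.letter_snd i) (D.letter_fst j)
  have e4 := hne _ _ (D.letter_snd i) (D.letter_snd j)
  have h := D.fst_lt_snd i
  have h1 : D.src (D.fst i) = D.fst i ∨ D.src (D.fst i) = D.fst i + 1 := by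
    have := D.src_cases (D.fst i); omega
  have h2 : D.src (D.snd i) = D.snd i ∨ D.src (D.snd i) = D.snd i + 1 := by
    have := D.src_cases (D.snd i); omega
  have key : ∀ b (s : ℤ), D.fst i ≠ b → D.snd i ≠ b →
      (if b < D.src (D.snd i) then s else 0) - (if b < D.src (D.fst i) then s else 0)
        = if D.fst i < b ∧ b < D.snd i then s else 0 := by
    intro b s hb1 hb2
    split_ifs <;> omega
  rw [crossing, passed, passed, ← key _ _ e1 e3, ← key _ _ e2 e4]
  ring

/-- Either some gap can be changed by one while the path stays closed, or all gaps are determined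
by the word. -/
theorem exists_gap_eq_one_or :
    (∃ i μ, ∑ j, D.weight j * μ j = 0 ∧ (∀ j, |μ j| ≤ 1) ∧
      (D.gap (varHeight μ) i = 1 ∨ D.gap (varHeight μ) i = -1)) ∨
    ∀ i μ, ∑ j, D.weight j * μ j = 0 → D.gap (varHeight μ) i = 0 := by
  by_contra hcon
  rw [not_or] at hcon
  obtain ⟨hno, hcon⟩ := hcon
  apply hcon
  push Not at hno
  simp only [gap_varHeight] at hno ⊢
  -- Changing one orientable exponent keeps the path closed. Its crossing number is 0 or `±1`, so
  -- the assumption leaves 0: an orientable variable is interlaced with no other one.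
  have horient : ∀ i j, D.weight j = 0 → D.crossing i j = 0 := by
    intro i j hj
    have h1 := hno i (Pi.single j 1) (by simp [Pi.single_apply, hj]) (by
      intro l; rw [Pi.single_apply]; split_ifs <;> simp)
    simp only [Pi.single_apply, mul_ite, mul_one, mul_zero, Finset.sum_ite_eq', Finset.mem_univ,
      if_true] at h1
    by_cases hij : i = j
    · subst hij; exact (D.crossing_self i).1 hj
    · rw [D.crossing_of_ne hij] at h1 ⊢
      have := (D.weight_eq j)
      have := D.sign_eq (D.fst j)
      split_ifs at h1 ⊢ <;> omega
  -- For two nonorientable variables, opposite changes of the exponents, normalised by sign, keep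
  -- the path closed.
  have hdiff : ∀ i v w, D.weight v ≠ 0 → D.weight w ≠ 0 →
      D.sign (D.fst v) * D.crossing i v - D.sign (D.fst w) * D.crossing i w ≠ 1 ∧
      D.sign (D.fst v) * D.crossing i v - D.sign (D.fst w) * D.crossing i w ≠ -1 := by
    intro i v w hv hw
    by_cases hvw : v = w
    · subst hvw; simp
    have h1 := hno i (Pi.single v (D.sign (D.fst v)) - Pi.single w (D.sign (D.fst w))) (by
      have hv' := D.weight_eq v
      have hw' := D.weight_eq w
      simp only [Pi.sub_apply, mul_sub, Finset.sum_sub_distrib, Pi.single_apply, mul_ite, mul_zero,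
        Finset.sum_ite_eq', Finset.mem_univ, if_true]
      rcases D.sign_eq (D.fst v) with e1 | e1 <;> rcases D.sign_eq (D.fst w) with e2 | e2 <;>
        rw [e1] at hv' ⊢ <;> rw [e2] at hw' ⊢ <;> omega) (by
      intro l
      simp only [Pi.sub_apply, Pi.single_apply]
      split_ifs with a b
      · exact absurd (a.symm.trans b) hvw
      · simp [abs_sign]
      · simp [abs_sign]
      · simp)
    simp only [Pi.sub_apply, mul_sub, Finset.sum_sub_distrib, Pi.single_apply, mul_ite, mul_zero,
      Finset.sum_ite_eq', Finset.mem_univ, if_true] at h1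
    rw [mul_comm (D.sign (D.fst v)), mul_comm (D.sign (D.fst w))]
    exact h1
  -- The normalised crossing of `v` with itself is 1, and with `w` it is 0, 1 or 2. Only 1 survives
  -- `hdiff`, so any two nonorientable variables are interlaced.
  have hnonor : ∀ v w, v ≠ w → D.weight v ≠ 0 → D.weight w ≠ 0 →
      D.sign (D.fst w) * D.crossing v w = 1 := by
    intro v w hvw hv hw
    have h1 := hdiff v v w hv hw
    rw [(D.crossing_self v).2 hv, D.crossing_of_ne hvw] at h1
    rw [D.crossing_of_ne hvw]
    have h2 := (D.weight_eq w).resolve_left fun h => hw h.1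
    rw [h2.2] at h1 ⊢
    rcases D.sign_eq (D.fst v) with e1 | e1 <;> rcases D.sign_eq (D.fst w) with e2 | e2 <;>
      rw [e1, e2] at h1 <;> rw [e2] <;> split_ifs at h1 ⊢ <;> omega
  have hconst : ∀ i v w, D.weight v ≠ 0 → D.weight w ≠ 0 →
      D.sign (D.fst v) * D.crossing i v = D.sign (D.fst w) * D.crossing i w := by
    intro i v w hv hw
    by_cases hvw : v = w
    · rw [hvw]
    have hone : ∀ v, D.weight v ≠ 0 → D.sign (D.fst v) * D.sign (D.fst v) = 1 := fun v _ => by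
      rcases D.sign_eq (D.fst v) with e | e <;> rw [e] <;> norm_num
    by_cases hi : D.weight i = 0
    · have hiv : i ≠ v := fun h => hv (h ▸ hi)
      have hiw : i ≠ w := fun h => hw (h ▸ hi)
      have a1 := horient v i hi
      have a2 := horient w i hi
      have a3 := hnonor v w hvw hv hw
      have a4 := hnonor w v (Ne.symm hvw) hw hv
      rw [D.crossing_of_ne hiv.symm] at a1
      rw [D.crossing_of_ne hiw.symm] at a2
      rw [D.crossing_of_ne hvw] at a3
      rw [D.crossing_of_ne (Ne.symm hvw)] at a4
      rw [D.crossing_of_ne hiv, D.crossing_of_ne hiw]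
      have h1 := (D.weight_eq v).resolve_left fun h => hv h.1
      have h2 := (D.weight_eq w).resolve_left fun h => hw h.1
      have p1 := D.fst_lt_snd i
      have p2 := D.fst_lt_snd v
      have p3 := D.fst_lt_snd w
      have s3 := D.sign_eq (D.fst i)
      have s4 := D.sign_eq (D.snd i)
      rw [h1.2] at a4 ⊢
      rw [h2.2] at a3 ⊢
      have key : ∀ (s : ℤ) (P Q : Prop) [Decidable P] [Decidable Q], s = 1 ∨ s = -1 →
          s * ((if P then s else 0) + (if Q then s else 0))
            = (if P then 1 else 0) + (if Q then 1 else 0) := by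
        rintro s P Q _ _ (rfl | rfl) <;> split_ifs <;> rfl
      rw [key _ _ _ (D.sign_eq _)] at a3 a4
      rw [key _ _ _ (D.sign_eq _), key _ _ _ (D.sign_eq _)]
      have hne : ∀ a b j, j ≠ i → (D.letter a).1 = Sum.inl i → (D.letter b).1 = Sum.inl j →
          a ≠ b := by
        rintro a _ j hj ha hb rfl
        exact hj (Sum.inl_injective (hb.symm.trans ha))
      have q1 := hne _ _ v hiv.symm (D.letter_fst i) (D.letter_fst v)
      have q2 := hne _ _ v hiv.symm (D.letter_fst i) (D.letter_snd v)
      have q3 := hne _ _ v hiv.symm (D.letter_snd i) (D.letter_fst v)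
      have q4 := hne _ _ v hiv.symm (D.letter_snd i) (D.letter_snd v)
      have q5 := hne _ _ w hiw.symm (D.letter_fst i) (D.letter_fst w)
      have q6 := hne _ _ w hiw.symm (D.letter_fst i) (D.letter_snd w)
      have q7 := hne _ _ w hiw.symm (D.letter_snd i) (D.letter_fst w)
      have q8 := hne _ _ w hiw.symm (D.letter_snd i) (D.letter_snd w)
      -- The orientable `i` is interlaced neither with `v` nor with `w`, while these are interlaced
      -- with each other. Hence `v` and `w` lie together inside or together outside the interval of
      -- `i`.
      have b1 : (D.fst v < D.fst i ∧ D.fst i < D.snd v) ↔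
          (D.fst v < D.snd i ∧ D.snd i < D.snd v) := by
        split_ifs at a1 <;> omega
      have b2 : (D.fst w < D.fst i ∧ D.fst i < D.snd w) ↔
          (D.fst w < D.snd i ∧ D.snd i < D.snd w) := by
        split_ifs at a2 <;> omega
      have b3 : (D.fst v < D.fst w ∧ D.fst w < D.snd v) ↔
          ¬(D.fst v < D.snd w ∧ D.snd w < D.snd v) := by
        split_ifs at a3 <;> omega
      have c1 : (D.fst i < D.fst v ∧ D.fst v < D.snd i) ↔
          (D.fst i < D.fst w ∧ D.fst w < D.snd i) := by omega
      have c2 : (D.fst i < D.snd v ∧ D.snd v < D.snd i) ↔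
          (D.fst i < D.snd w ∧ D.snd w < D.snd i) := by omega
      simp only [c1, c2]
    · have aux : ∀ v, D.weight v ≠ 0 → D.sign (D.fst v) * D.crossing i v = 1 := by
        intro v hv
        by_cases h : i = v
        · subst h; rw [(D.crossing_self i).2 hv]; exact hone i hv
        · exact hnonor i v h hi hv
      rw [aux v hv, aux w hw]
  intro i μ hμ
  by_cases hall : ∀ j, D.weight j = 0
  · exact Finset.sum_eq_zero fun j _ => by rw [horient i j (hall j), zero_mul]
  push Not at hall
  obtain ⟨v, hv⟩ := hall
  -- The crossings with `i` are thus proportional to the weights, so a change of total weight 0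
  -- leaves the gap of `i` unchanged.
  have h1 : ∀ j, 2 * (D.crossing i j * μ j)
      = D.sign (D.fst v) * D.crossing i v * (D.weight j * μ j) := by
    intro j
    by_cases hj : D.weight j = 0
    · rw [horient i j hj, hj]; ring
    · rw [hconst i v j hv hj, ((D.weight_eq j).resolve_left fun h => hj h.1).1]
      rcases D.sign_eq (D.fst j) with e | e <;> rw [e] <;> ring
  have h2 : 2 * ∑ j, D.crossing i j * μ j = 0 := by
    rw [Finset.mul_sum, Finset.sum_congr rfl fun j _ => h1 j, ← Finset.mul_sum, hμ, mul_zero]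
  omega

end QuadraticWord

/-! ### The size bounds for nonzero `n` -/

namespace QuadraticWord

variable {k : ℕ} (D : QuadraticWord k)

/-- The hypothesis that `g` solves the equation `W = 1`, read through `D`. -/
structure Reads {n : ℤ} (u : ℚˣ) (W : EqWord k) (g : Fin k → BS 1 n) : Prop where
  letter_eq : D.letter = fun j => W.getD j (Sum.inr BSGen.a, true)
  len_eq : D.len = W.length
  isSolution : W.IsSolution g
  unit_eq : (u : ℚ) = n

/-- There is a solution of cubic size. -/
def HasSmallSolution (n : ℤ) (W : EqWord k) : Prop :=
  ∃ g : Fin k → BS 1 n, W.IsSolution g ∧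
    BS.tupleSize g ≤ (n.natAbs + 2) * 1000 * W.length ^ 3

variable {D} {n : ℤ} {u : ℚˣ} {W : EqWord k} {g : Fin k → BS 1 n}

/-- The power of `n` at the lower occurrence is factored out; `s` is the sign of the higher one. -/
theorem intCoeff_eq_of_gap {m : Fin k → ℤ} {B : ℕ}
    (hB : ∀ l ≤ D.len, |D.height (letterHeight m) l| ≤ B) (i : Fin k) :
    ∃ e ≤ 2 * B, ∃ s : ℤ, (s = 1 ∨ s = -1) ∧ D.intCoeff n B m i
      = s * n ^ e * (n ^ (D.gap (letterHeight m) i).natAbs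
        + D.sign (D.fst i) * D.sign (D.snd i)) := by
  have h1 := abs_le.mp (hB _ (D.src_le (D.fst_lt i)))
  have h2 := abs_le.mp (hB _ (D.src_le (D.snd_lt i)))
  rw [intCoeff, shiftedPow, shiftedPow, gap]
  generalize D.height (letterHeight m) (D.src (D.fst i)) = a at *
  generalize D.height (letterHeight m) (D.src (D.snd i)) = b at *
  rcases le_total a b with hab | hab
  · refine ⟨(B + a).toNat, by omega, D.sign (D.snd i), D.sign_eq _, ?_⟩
    have e : (B + b).toNat = (B + a).toNat + (b - a).natAbs := by omega
    rw [e, pow_add]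
    rcases D.sign_eq (D.fst i) with e1 | e1 <;> rcases D.sign_eq (D.snd i) with e2 | e2 <;>
      rw [e1, e2] <;> ring
  · refine ⟨(B + b).toNat, by omega, D.sign (D.fst i), D.sign_eq _, ?_⟩
    have e : (B + a).toNat = (B + b).toNat + (b - a).natAbs := by omega
    rw [e, pow_add]
    rcases D.sign_eq (D.fst i) with e1 | e1 <;> rcases D.sign_eq (D.snd i) with e2 | e2 <;>
      rw [e1, e2] <;> ring

/-- The criterion `exists_isSolution_of_congr` with bounds in terms of the length of the word. -/
theorem Reads.hasSmallSolution_of_congr (h : D.Reads u W g) (hn : n ≠ 0) {τ : ℕ} (hτ : 0 < τ)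
    {m' : Fin k → ℤ}
    (hcong : ∀ j, (τ : ℤ) ∣ m' j - (BS.toScaleTranslate u h.unit_eq (g j)).exp)
    (hclosed : D.height (letterHeight m') D.len = 0)
    (hm' : D.len + 2 * ∑ j, |m' j| ≤ (50 * D.len ^ 2 : ℕ)) {i : Fin k} {M : ℕ} (hM : 0 < M)
    (hper : (M : ℤ) ∣ n ^ τ - 1) (hQ : M ≤ 2 * n.natAbs ^ (10 * D.len)) {f : ℤ} {e : ℕ}
    (he : e ≤ 1) (hfn : |f| ≤ |n|)
    (hf : (n ^ (D.gap (letterHeight m') i).natAbs + D.sign (D.fst i) * D.sign (D.snd i)) * f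
      = M * n ^ e)
    (hdvd : (M : ℤ) ∣
      n ^ (D.gap (letterHeight m') i).natAbs + D.sign (D.fst i) * D.sign (D.snd i)) :
    HasSmallSolution n W := by
  obtain ⟨e', he', s, hs, hcoeff⟩ := intCoeff_eq_of_gap (n := n) (D := D)
    (fun l hl => (D.abs_height_le m' hl).trans hm') i
  have hss : s * s = 1 := by rcases hs with rfl | rfl <;> norm_num
  obtain ⟨g', hg', hsize⟩ := D.exists_isSolution_of_congr hn h.letter_eq h.len_eq h.isSolution
    h.unit_eq hM hτ hper hcong hclosed hm' (i := i) (f := s * f) (e := e' + e) (Q := 10 * D.len)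
    (by rw [hcoeff, pow_add]; linear_combination s * s * n ^ e' * hf + M * n ^ e' * n ^ e * hss)
    (by rw [hcoeff]; exact Dvd.dvd.mul_left hdvd _)
    (by
      rw [abs_mul]
      rcases hs with rfl | rfl <;> simpa using hfn)
    (by omega) hQ
  refine ⟨g', hg', hsize.trans ?_⟩
  rw [← h.len_eq, mul_assoc]
  refine Nat.mul_le_mul_left _ ?_
  -- The bound is in fact quadratic: `k * (10 * D.len + 2)` is at most `12 * D.len ^ 2`, and `9 * B`
  -- is `450 * D.len ^ 2`.
  have h1 := D.two_mul_card_le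
  have h2 : 1 ≤ D.len := by have := D.snd_lt i; omega
  have h3 : k * (10 * D.len + 2) ≤ D.len * (12 * D.len) := Nat.mul_le_mul (by omega) (by omega)
  have h4 : D.len ^ 2 ≤ D.len ^ 3 := Nat.pow_le_pow_right h2 (by norm_num)
  have h5 : 1 ≤ D.len ^ 3 := Nat.one_le_pow _ _ h2
  have h6 : D.len * (12 * D.len) = 12 * D.len ^ 2 := by ring
  omega

theorem sign_mul_sign (i : Fin k) : D.sign (D.fst i) * D.sign (D.snd i) = 1 ∨
    D.sign (D.fst i) * D.sign (D.snd i) = -1 := by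
  rcases D.sign_eq (D.fst i) with e1 | e1 <;> rcases D.sign_eq (D.snd i) with e2 | e2 <;>
    rw [e1, e2] <;> norm_num

/-- The coefficient is `±2 * n ^ e`. For even `n` the factor 2 divides `n`, so `M = 1` works; for
odd `n`, `M = 2` and `n` is 1 modulo 2. Either way `τ = 1`, and the exponents are free as long as
the path closes. -/
theorem Reads.hasSmallSolution_of_gap_eq_zero (h : D.Reads u W g) (hn : 2 ≤ |n|)
    {m' : Fin k → ℤ} (hclosed : D.height (letterHeight m') D.len = 0)
    (hm' : D.len + 2 * ∑ j, |m' j| ≤ (50 * D.len ^ 2 : ℕ)) {i : Fin k}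
    (hgap : D.gap (letterHeight m') i = 0)
    (hi : D.sign (D.fst i) * D.sign (D.snd i) = 1) : HasSmallSolution n W := by
  have hn0 : n ≠ 0 := by rintro rfl; simp at hn
  have hnn : 2 ≤ n.natAbs := by rw [Int.abs_eq_natAbs] at hn; exact_mod_cast hn
  have hpow : 1 ≤ n.natAbs ^ (10 * D.len) := Nat.one_le_pow _ _ (by omega)
  rcases Int.even_or_odd n with hev | hodd
  · obtain ⟨c, hc⟩ := hev
    refine h.hasSmallSolution_of_congr hn0 one_pos (by simp) hclosed hm' (i := i) (M := 1) one_pos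
      (by simp) (by omega) (f := c) (e := 1) le_rfl ?_ ?_ (by simp)
    · rw [hc, ← two_mul, abs_mul]; norm_num; linarith [abs_nonneg c]
    · rw [hgap, hi, hc]; simp; ring
  · obtain ⟨c, hc⟩ := hodd
    refine h.hasSmallSolution_of_congr hn0 one_pos (by simp) hclosed hm' (i := i) (M := 2) two_pos
      ?_ (by omega) (f := 1) (e := 0) zero_le_one ?_ ?_ ?_
    · rw [hc]; exact ⟨c, by push_cast; ring⟩
    · rw [abs_one]; linarith
    · rw [hgap, hi]; norm_num
    · rw [hgap, hi]; norm_num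

theorem exists_sign_mul_eq_natAbs (z : ℤ) : ∃ f : ℤ, |f| ≤ 1 ∧ z * f = z.natAbs := by
  rcases Int.natAbs_eq z with h | h
  · exact ⟨1, by simp, by omega⟩
  · exact ⟨-1, by simp, by omega⟩

/-- The coefficient is `±(n - 1) * n ^ e`, and `n` is 1 modulo `n - 1`, so again `τ = 1`. -/
theorem Reads.hasSmallSolution_of_gap_eq_one (h : D.Reads u W g) (hn : 2 ≤ |n|)
    {m' : Fin k → ℤ} (hclosed : D.height (letterHeight m') D.len = 0)
    (hm' : D.len + 2 * ∑ j, |m' j| ≤ (50 * D.len ^ 2 : ℕ)) {i : Fin k}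
    (hgap : D.gap (letterHeight m') i = 1)
    (hi : D.sign (D.fst i) * D.sign (D.snd i) = -1) : HasSmallSolution n W := by
  have hn0 : n ≠ 0 := by rintro rfl; simp at hn
  have hnn : 2 ≤ n.natAbs := by rw [Int.abs_eq_natAbs] at hn; exact_mod_cast hn
  have hlen : 1 ≤ D.len := by have := D.snd_lt i; omega
  have hpow : n.natAbs ^ 1 ≤ n.natAbs ^ (10 * D.len) :=
    Nat.pow_le_pow_right (by omega) (by omega)
  rw [pow_one] at hpow
  obtain ⟨f, hf1, hf⟩ := exists_sign_mul_eq_natAbs (n - 1)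
  refine h.hasSmallSolution_of_congr hn0 one_pos (by simp) hclosed hm' (i := i)
    (M := (n - 1).natAbs) (by omega) (by simp) (by omega) (f := f) (e := 0) zero_le_one
    (by linarith) ?_ ?_
  · rw [hgap, hi]; simpa [← sub_eq_add_neg] using hf
  · rw [hgap, hi]; simp [← sub_eq_add_neg]

/-- With `d` the absolute gap and `σ = ±1`, `(n ^ d + σ) * (n ^ d - σ) = n ^ (2 * d) - 1`, so `2 *
d` is a period of `n` modulo the coefficient. -/
theorem Reads.hasSmallSolution_of_gap_ne_zero (h : D.Reads u W g) (hn : 2 ≤ |n|)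
    {m' : Fin k → ℤ} {i : Fin k} (hgap : D.gap (letterHeight m') i ≠ 0)
    (hle : (D.gap (letterHeight m') i).natAbs ≤ 10 * D.len)
    (hcong : ∀ j, ((2 * (D.gap (letterHeight m') i).natAbs : ℕ) : ℤ) ∣
      m' j - (BS.toScaleTranslate u h.unit_eq (g j)).exp)
    (hclosed : D.height (letterHeight m') D.len = 0)
    (hm' : D.len + 2 * ∑ j, |m' j| ≤ (50 * D.len ^ 2 : ℕ)) : HasSmallSolution n W := by
  have hn0 : n ≠ 0 := by rintro rfl; simp at hn
  have hnn : 2 ≤ n.natAbs := by rw [Int.abs_eq_natAbs] at hn; exact_mod_cast hn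
  set d := (D.gap (letterHeight m') i).natAbs with hd
  have hd0 : 0 < d := Int.natAbs_pos.mpr hgap
  set σ := D.sign (D.fst i) * D.sign (D.snd i) with hσ
  have hσ1 : σ = 1 ∨ σ = -1 := sign_mul_sign i
  obtain ⟨f, hf1, hf⟩ := exists_sign_mul_eq_natAbs (n ^ d + σ)
  have hpow : n.natAbs ^ d ≤ n.natAbs ^ (10 * D.len) := Nat.pow_le_pow_right (by omega) hle
  have hbig : 2 ≤ n.natAbs ^ d := by
    calc 2 ≤ n.natAbs ^ 1 := by rw [pow_one]; exact hnn
      _ ≤ n.natAbs ^ d := Nat.pow_le_pow_right (by omega) hd0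
  rw [← Int.natAbs_pow] at hpow hbig
  refine h.hasSmallSolution_of_congr hn0 (τ := 2 * d) (by omega) hcong hclosed hm' (i := i)
    (M := (n ^ d + σ).natAbs) (by omega) ?_ (by omega) (f := f) (e := 0) zero_le_one
    (by linarith) ?_ ?_
  · rw [Int.natAbs_dvd]
    exact ⟨n ^ d - σ, by rcases hσ1 with e | e <;> rw [e] <;> ring⟩
  · rw [← hd, ← hσ, pow_zero, mul_one, hf]
  · rw [← hd, ← hσ, Int.natAbs_dvd]

theorem coeff_eq_zero_of_gap_eq_zero {m : Fin k → ℤ} {i : Fin k}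
    (hgap : D.gap (letterHeight m) i = 0)
    (hi : D.sign (D.fst i) * D.sign (D.snd i) = -1) : D.coeff u m i = 0 := by
  rw [gap, sub_eq_zero] at hgap
  have e : D.sign (D.snd i) = -D.sign (D.fst i) := by
    rcases D.sign_eq (D.fst i) with e1 | e1 <;> rcases D.sign_eq (D.snd i) with e2 | e2 <;>
      rw [e1, e2] at hi ⊢ <;> omega
  rw [coeff, hgap, e]
  push_cast; ring

theorem Reads.hasSmallSolution_of_two_le (h : D.Reads u W g) (hn : 2 ≤ |n|) :
    HasSmallSolution n W := by
  have hsol := D.solves_of_isSolution u h.unit_eq h.letter_eq h.len_eq h.isSolution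
  set m : Fin k → ℤ := fun j => (BS.toScaleTranslate u h.unit_eq (g j)).exp with hm
  have hk := D.two_mul_card_le
  by_cases hc : ∀ i, D.coeff u m i = 0
  · obtain ⟨g', hg', hsize⟩ := D.exists_isSolution_of_coeff_eq_zero hn h.letter_eq h.len_eq
      h.unit_eq hsol hc
    refine ⟨g', hg', hsize.trans ?_⟩
    rw [← h.len_eq]
    rcases Nat.eq_zero_or_pos k with rfl | hk0
    · simp
    have h1 : 1 ≤ D.len := by omega
    calc k * ((D.len + 2) * (D.len + 1)) ≤ D.len * ((3 * D.len) * (2 * D.len)) :=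
          Nat.mul_le_mul (by omega) (Nat.mul_le_mul (by omega) (by omega))
      _ = 6 * D.len ^ 3 := by ring
      _ ≤ (n.natAbs + 2) * 1000 * D.len ^ 3 := Nat.mul_le_mul_right _ (by omega)
  push Not at hc
  obtain ⟨i₀, hi₀⟩ := hc
  have hL : (1 : ℤ) ≤ D.len := by have := D.snd_lt i₀; omega
  have hkL : (2 * k : ℤ) ≤ D.len := by exact_mod_cast hk
  -- Reduction modulo 1 imposes no congruence and just yields closed exponents of total size at most
  -- `2 * D.len`.
  obtain ⟨m₀, hm₀, -, hm₀b⟩ := D.exists_small_congr hsol.1 one_pos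
  push_cast at hm₀b
  have hgap₀ : ∀ i, |D.gap (letterHeight m₀) i| ≤ 10 * D.len := fun i => by
    have := D.abs_gap_le m₀ i; linarith
  rcases D.exists_gap_eq_one_or with ⟨i, μ, hμ, hμ1, hμi⟩ | hzero
  -- The target gap `T` must avoid a zero coefficient: 0 for equal signs, 1 for opposite signs. The
  -- multiple `c` of `μ` moves the gap there from its value at `m₀`.
  · obtain ⟨T, hT, hTi⟩ : ∃ T : ℤ, |T| ≤ 1 ∧
        ((T = 0 ∧ D.sign (D.fst i) * D.sign (D.snd i) = 1) ∨
          (T = 1 ∧ D.sign (D.fst i) * D.sign (D.snd i) = -1)) := by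
      rcases sign_mul_sign (D := D) i with e | e
      · exact ⟨0, by simp, Or.inl ⟨rfl, e⟩⟩
      · exact ⟨1, by simp, Or.inr ⟨rfl, e⟩⟩
    obtain ⟨c, hc, hcT⟩ : ∃ c : ℤ, |c| ≤ 10 * D.len + 1 ∧
        D.gap (letterHeight m₀) i + c * D.gap (varHeight μ) i = T := by
      have h1 := abs_le.mp (hgap₀ i)
      rw [abs_le] at hT
      rcases hμi with e | e <;> rw [e]
      · exact ⟨T - D.gap (letterHeight m₀) i, by rw [abs_le]; constructor <;> linarith, by ring⟩
      · exact ⟨D.gap (letterHeight m₀) i - T, by rw [abs_le]; constructor <;> linarith, by ring⟩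
    have hclosed : D.height (letterHeight (m₀ + c • μ)) D.len = 0 := by
      rw [D.height_add_len, hm₀, zero_add]
      simp only [Pi.smul_apply, smul_eq_mul]
      rw [← mul_zero c, ← hμ, Finset.mul_sum]
      exact Finset.sum_congr rfl fun _ _ => by ring
    have hgap : D.gap (letterHeight (m₀ + c • μ)) i = T := by
      rw [D.gap_add, D.gap_smul, hcT]
    have hbound : D.len + 2 * ∑ j, |(m₀ + c • μ) j| ≤ (50 * D.len ^ 2 : ℕ) := by
      have h1 : ∑ j, |(m₀ + c • μ) j| ≤ ∑ j, |m₀ j| + k * (10 * D.len + 1) := by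
        have h2 : ∀ j, |(m₀ + c • μ) j| ≤ |m₀ j| + (10 * D.len + 1) := fun j => by
          refine (abs_add_le _ _).trans (add_le_add_right ?_ _)
          rw [Pi.smul_apply, smul_eq_mul, abs_mul]
          exact (mul_le_of_le_one_right (abs_nonneg _) (hμ1 j)).trans hc
        refine (Finset.sum_le_sum fun j _ => h2 j).trans ?_
        rw [Finset.sum_add_distrib]
        simp
      push_cast
      nlinarith
    rcases hTi with ⟨rfl, hi⟩ | ⟨rfl, hi⟩
    · exact h.hasSmallSolution_of_gap_eq_zero hn hclosed hbound hgap hi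
    · exact h.hasSmallSolution_of_gap_eq_one hn hclosed hbound hgap hi
  -- All closed exponents have the same gaps, so those of the given solution are as small as those
  -- of `m₀`.
  · have hgapconst : ∀ m' : Fin k → ℤ, D.height (letterHeight m') D.len = 0 →
        D.gap (letterHeight m') i₀ = D.gap (letterHeight m₀) i₀ := by
      intro m' hm'
      have e : m' = m₀ + (m' - m₀) := by abel
      have h1 := D.height_add_len m₀ (m' - m₀)
      rw [← e, hm', hm₀, zero_add] at h1
      rw [e, D.gap_add, hzero _ _ h1.symm, add_zero]
    by_cases hd : D.gap (letterHeight m₀) i₀ = 0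
    · refine h.hasSmallSolution_of_gap_eq_zero hn hm₀ ?_ hd
        ((sign_mul_sign i₀).resolve_right fun hi => hi₀ ?_)
      · push_cast; nlinarith
      · exact coeff_eq_zero_of_gap_eq_zero ((hgapconst m hsol.1).trans hd) hi
    · set d := D.gap (letterHeight m₀) i₀
      obtain ⟨m', hm', hcong, hb⟩ := D.exists_small_congr hsol.1 (τ := 2 * d.natAbs)
        (by have := Int.natAbs_pos.mpr hd; omega)
      have hg' := hgapconst m' hm'
      have hdle : (d.natAbs : ℤ) ≤ 10 * D.len := by
        rw [Int.natCast_natAbs]; exact hgap₀ i₀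
      refine h.hasSmallSolution_of_gap_ne_zero hn (m' := m') (i := i₀) (by rw [hg']; exact hd)
        (by rw [hg']; exact_mod_cast hdle) (by rw [hg']; exact hcong) hm' ?_
      push_cast at hb ⊢
      have h1 : D.len * |d| ≤ D.len * (10 * D.len) :=
        mul_le_mul_of_nonneg_left (hgap₀ i₀) (by positivity)
      nlinarith

theorem Reads.hasSmallSolution_of_natAbs_eq_one (h : D.Reads u W g) (hn : n.natAbs = 1) :
    HasSmallSolution n W := by
  have hn0 : n ≠ 0 := by rintro rfl; simp at hn
  have hn' : n = 1 ∨ n = -1 := by omega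
  have hsol := D.solves_of_isSolution u h.unit_eq h.letter_eq h.len_eq h.isSolution
  set m : Fin k → ℤ := fun j => (BS.toScaleTranslate u h.unit_eq (g j)).exp with hm
  have hu2 : u ^ (2 : ℤ) = 1 := by
    ext
    rw [Units.val_zpow_eq_zpow_val, h.unit_eq]
    rcases hn' with e | e <;> rw [e] <;> norm_num
  -- As `n ^ 2 = 1`, the rational coefficients depend only on parities and survive this reduction;
  -- each nonzero one is `±2`.
  obtain ⟨m', hm', hcong, hb⟩ := D.exists_small_congr hsol.1 (τ := 2) two_pos
  push_cast at hb hcong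
  have hcoeff := D.coeff_congr hu2 hcong
  by_cases hc : ∀ i, D.coeff u m i = 0
  · have hconst : D.const u m' = 0 := by
      rw [D.const_congr hu2 hcong]
      have := hsol.2
      simpa [hc] using this
    have hs : D.Solves u (fun i => (u ^ (0 : ℤ) : ℚˣ) * ((0 : ℤ) : ℚ)) m' :=
      ⟨hm', by simp [hconst]⟩
    refine ⟨_, D.isSolution_of_solves u h.unit_eq h.letter_eq h.len_eq
      (BS.toScaleTranslate_injective u h.unit_eq) hs, ?_⟩
    have h1 : ∀ i, BS.wordLength (BS.normalForm n 0 0 (m' i)) ≤ (m' i).natAbs := fun i => by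
      have := BS.wordLength_normalForm_le (n := n) 0 0 (m' i)
      rw [zpow_zero, BS.wordLength_one] at this
      simpa using this
    refine (Finset.sum_le_sum fun i _ => h1 i).trans ?_
    have h2 : ∑ i, (m' i).natAbs ≤ 3 * D.len := by zify; linarith
    rw [← h.len_eq]
    have h3 : D.len ≤ D.len ^ 3 := Nat.le_self_pow (by norm_num) _
    rw [hn]
    omega
  · push Not at hc
    obtain ⟨i, hi⟩ := hc
    have hL : (1 : ℤ) ≤ D.len := by have := D.snd_lt i; omega
    have hbound : D.len + 2 * ∑ j, |m' j| ≤ (50 * D.len ^ 2 : ℕ) := by push_cast; nlinarith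
    set c := n ^ (D.gap (letterHeight m') i).natAbs + D.sign (D.fst i) * D.sign (D.snd i) with hcdef
    have hc0 : c ≠ 0 := by
      intro hc0
      have hB := fun l hl => (D.abs_height_le m' (l := l) hl).trans hbound
      obtain ⟨e, -, s, -, h1⟩ := intCoeff_eq_of_gap (n := n) (D := D) hB i
      rw [← hcdef, hc0, mul_zero] at h1
      have h2 := D.cast_intCoeff h.unit_eq hB i
      rw [h1, hcoeff, Int.cast_zero] at h2
      exact hi ((Units.mul_right_eq_zero _).mp h2.symm)
    have hc2 : c = 2 ∨ c = -2 := by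
      have h1 : n ^ (D.gap (letterHeight m') i).natAbs = 1 ∨
          n ^ (D.gap (letterHeight m') i).natAbs = -1 := by
        rcases hn' with e | e <;> rw [e]
        · simp
        · exact neg_one_pow_eq_or ℤ _
      have h2 := sign_mul_sign (D := D) i
      omega
    obtain ⟨f, hf1, hf⟩ := exists_sign_mul_eq_natAbs c
    have hcn : c.natAbs = 2 := by omega
    refine h.hasSmallSolution_of_congr hn0 (τ := 1) one_pos (by simp) hm' hbound (i := i)
      (M := 2) two_pos ?_ (by rw [hn]; simp) (f := f) (e := 0) zero_le_one ?_ ?_ ?_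
    · rcases hn' with e | e <;> rw [e] <;> norm_num
    · have : |n| = 1 := by rw [Int.abs_eq_natAbs, hn]; rfl
      rw [this]; exact hf1
    · rw [← hcdef, hf, hcn]; simp
    · rw [← hcdef]; rcases hc2 with e | e <;> rw [e] <;> norm_num

end QuadraticWord

/-! ### The case `n = 0` and the conclusion -/

namespace BS

theorem ga_zero_eq_one : ga 0 = 1 := by
  have h := conj_relation 0
  rw [zpow_zero] at h
  have h1 : ga 0 = gt 0 * ((gt 0)⁻¹ * ga 0 * gt 0) * (gt 0)⁻¹ := by group
  rw [h1, h]; group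

/-- In the zero ring `ZMod 1` the element 0 is a unit and only exponents remain. Nothing is lost,
because `a = 1` when `n = 0`. -/
theorem toScaleTranslate_zero_injective (u : (ZMod 1)ˣ) (hu : (u : ZMod 1) = (0 : ℤ)) :
    Function.Injective (toScaleTranslate u hu) := by
  rw [injective_iff_map_eq_one]
  intro g hg
  obtain ⟨p, q, j, rfl⟩ := exists_pow_mul_zpow_mul_pow g
  have e : gt 0 ^ p * ga 0 ^ j * (gt 0)⁻¹ ^ q = normalForm 0 (-p) j (q - p) := by
    rw [normalForm, neg_neg, zpow_natCast, inv_pow, ← zpow_natCast _ q, ← zpow_neg]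
    congr 2; ring
  rw [e, toScaleTranslate_normalForm] at hg
  have h2 := congrArg ScaleTranslate.exp hg
  simp only [ScaleTranslate.one_exp] at h2
  have h5 : p = q := by omega
  subst h5
  rw [ga_zero_eq_one]
  simp

end BS

theorem QuadraticWord.hasSmallSolution_zero {k : ℕ} (D : QuadraticWord k) {W : EqWord k}
    (hD : D.letter = fun j => W.getD j (Sum.inr BSGen.a, true)) (hlen : D.len = W.length)
    {g : Fin k → BS 1 0} (hg : W.IsSolution g) : HasSmallSolution 0 W := by
  have hu : ((1 : (ZMod 1)ˣ) : ZMod 1) = (0 : ℤ) := Subsingleton.elim _ _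
  have hsol := D.solves_of_isSolution 1 hu hD hlen hg
  obtain ⟨m', hm', -, hb⟩ := D.exists_small_congr hsol.1 one_pos
  have hs : D.Solves 1 (fun i => (((1 : (ZMod 1)ˣ) ^ (0 : ℤ) : (ZMod 1)ˣ) : ZMod 1)
      * ((0 : ℤ) : ZMod 1)) m' := ⟨hm', Subsingleton.elim _ _⟩
  refine ⟨_, D.isSolution_of_solves 1 hu hD hlen
    (BS.toScaleTranslate_zero_injective 1 hu) hs, ?_⟩
  have h1 : ∀ i, BS.wordLength (BS.normalForm 0 0 0 (m' i)) ≤ (m' i).natAbs := fun i => by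
    have := BS.wordLength_normalForm_le (n := 0) 0 0 (m' i)
    rw [zpow_zero, BS.wordLength_one] at this
    simpa using this
  refine (Finset.sum_le_sum fun i _ => h1 i).trans ?_
  push_cast at hb
  have h2 : ∑ i, (m' i).natAbs ≤ 2 * D.len := by zify; linarith
  rw [← hlen]
  have h3 : D.len ≤ D.len ^ 3 := Nat.le_self_pow (by norm_num) _
  simp only [Int.natAbs_zero]
  omega

theorem theorem3 (n : ℤ) :
    ∃ C : ℕ, ∀ (k : ℕ) (W : EqWord k), W.IsQuadratic →
      (∃ g : Fin k → BS 1 n, W.IsSolution g) →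
        ∃ g : Fin k → BS 1 n, W.IsSolution g ∧ BS.tupleSize g ≤ C * W.length ^ 3 := by
  refine ⟨(n.natAbs + 2) * 1000, fun k W hW ⟨g, hg⟩ => ?_⟩
  obtain ⟨D, hlen, hD⟩ := hW.exists_quadraticWord
  rcases eq_or_ne n 0 with rfl | hn
  · exact D.hasSmallSolution_zero hD hlen hg
  · have hnQ : (n : ℚ) ≠ 0 := by exact_mod_cast hn
    have h : D.Reads (Units.mk0 (n : ℚ) hnQ) W g := ⟨hD, hlen, hg, rfl⟩
    rcases Nat.lt_or_ge n.natAbs 2 with h1 | h1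
    · exact h.hasSmallSolution_of_natAbs_eq_one (by omega)
    · exact h.hasSmallSolution_of_two_le (by rw [Int.abs_eq_natAbs]; exact_mod_cast h1)
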